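/- Let $n\ge 2$, let $V=\mathbb{R}^n$ and $V^{\mathbb C}=\mathbb{C}\otimes V=\mathbb{C}^n$, regarded as a real vector space of dimension $2n$, and let $\mathfrak g=\mathbb{R}\,\mathrm{i}I_n\oplus\mathfrak{gl}(n,\mathbb{R})\subset\mathfrak{gl}(n,\mathbb{C})$ be the Lie algebra of $S^1\cdot\mathrm{GL}(n,\mathbb{R})\subset\mathrm{GL}(2n,\mathbb{R})$. Let $\mathcal K(\mathfrak g)\subset\mathfrak g\otimes\Lambda^2((V^{\mathbb C})^*)$ be the space of curvature tensors of torsion-free $\mathfrak g$-connections, i.e. of those $\kappa$ with $\kappa(x,y)z+\kappa(y,z)x+\kappa(z,x)y=0$ for all $x,y,z\in V^{\mathbb C}$. Let $\mathcal K_\circ(\mathfrak g)\subset\mathcal K(\mathfrak g)$ be the subspace of curvature tensors of integrable torsion-free $S^1\cdot\mathrm{GL}(n,\mathbb{R})$-structures, i.e. of those $\kappa=\mathrm{i}\,\Omega_0 I_n+\Phi$ (with $\Omega_0$ real-valued and $\Phi$ with values in $\mathfrak{gl}(n,\mathbb{R})$) for which $\Omega_0$ vanishes on each of the totally real $n$-planes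 $\mathrm{e}^{\mathrm{i}\theta}\mathbb{R}^n\subset\mathbb{C}^n$. Recall, for a second-level tableau, i.e. a linear subspace $K\subset W\otimes\Lambda^2(E^*)$ with $E$ and $W$ real vector spaces of finite dimension: its Cartan characters $s_0,\dots,s_{\dim E}$ are defined by the condition that $s_0+\dots+s_k$ is the maximum, over the $k$-dimensional subspaces $F\subset E$ (equivalently, the value at a generic $F$), of the dimension of the image of $K$ in $W\otimes\Lambda^2(F^*)$; its prolongation is $K^{(1)}=(K\otimes E^*)\cap\ker\bigl(W\otimes\Lambda^2(E^*)\otimes E^*\to W\otimes\Lambda^3(E^*)\bigr)$; it is involutive if $\dim K^{(1)}=\sum_k k\,s_k$; and, for $\Bbbk=\mathbb{R}$ or $\mathbb{C}$, a nonzero covector $\xi\in E^*\otimes\Bbbk$ is characteristic if $K\otimes\Bbbk$ contains a nonzero element of the form $\xi\wedge u$ with $u\in W\otimes E^*\otimes\Bbbk$. The (real, respectively complex) characteristic variety of $K$ is the set of characteristic points in $\mathbb{P}(E^*\otimes\Bbbk)$. **Proposition.** The space $\mathcal K_\circ(\mathfrak g)\subset\mathfrak g\otimes\Lambda^2((V^{\mathbb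 C})^*)$, regarded as a second-level tableau, is involutive. Its Cartan characters are $$s_k=\begin{cases}k-1+n\bigl(n+(k-2)(n+1-k)\bigr), & 2\le k\le n+1,\\ 0, & k=0,1\ \text{ or }\ n+1<k\le 2n.\end{cases}$$ Its characteristic variety, over $\mathbb{R}$ as well as over $\mathbb{C}$, consists exactly of the points of $\mathbb{P}((\mathbb{C}\otimes V)^*)\simeq\mathbb{P}^{2n-1}$ represented by covectors of the form $\lambda\otimes\xi'$, where $\lambda$ is a nonzero covector on $\mathbb{C}\simeq\mathbb{R}^2$ and $\xi'$ is a nonzero covector on $V$ (both with coefficients in the field in question). As a complex projective variety in $\mathbb{P}^{2n-1}$, it has degree $n$. (The degree of $X\subset\mathbb{P}^N$ is $r!$ times the leading coefficient of its Hilbert function $t\mapsto\dim(S/I(X))_t\sim d\,t^r/r!$.) -/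

import Mathlib

open scoped TensorProduct LinearAlgebra.Projectivization

/-! ## Second-level tableaux -/

section Tableau

/-- A second-level tableau: a linear subspace of `W ⊗ Λ²(E*)`, the space of
alternating bilinear maps on the real vector space `E` with values in `W`. -/
abbrev SecondLevelTableau (E W : Type*) [AddCommGroup E] [Module ℝ E]
    [AddCommGroup W] [Module ℝ W] : Type _ :=
  Submodule ℝ (E [⋀^Fin 2]→ₗ[ℝ] W)

namespace SecondLevelTableau

variable {E W : Type*} [AddCommGroup E] [Module ℝ E] [AddCommGroup W] [Module ℝ W]

/-- Restriction of `W`-valued 2-forms from `E` to a linear subspace `F`. -/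
def restrict (F : Submodule ℝ E) : (E [⋀^Fin 2]→ₗ[ℝ] W) →ₗ[ℝ] (F [⋀^Fin 2]→ₗ[ℝ] W) where
  toFun κ := κ.compLinearMap F.subtype
  map_add' _ _ := rfl
  map_smul' _ _ := rfl

/-- The largest dimension of the image of `K` under restriction to a `k`-dimensional subspace
of `E`. It is attained exactly on the members of a nonempty Zariski-open set of subspaces, so
it is the rank of the restriction to the `k`-th member of a generic flag. -/
noncomputable def genericRank (K : SecondLevelTableau E W) (k : ℕ) : ℕ :=
  sSup {r : ℕ | ∃ F : Submodule ℝ E, Module.finrank ℝ F = k ∧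
    r = Module.finrank ℝ (K.map (restrict F))}

/-- The Cartan characters: `s₀ + ⋯ + s_k` is the rank of the restriction of `K` to the `k`-th
member of a generic flag (for `0 ≤ k ≤ dim E`). -/
noncomputable def cartanCharacter (K : SecondLevelTableau E W) : ℕ → ℤ
  | 0 => genericRank K 0
  | k + 1 => (genericRank K (k + 1) : ℤ) - genericRank K k

/-- The (first) prolongation `(K ⊗ E*) ∩ ker (W ⊗ Λ²(E*) ⊗ E* → W ⊗ Λ³(E*))`, with `K ⊗ E*`
realized as the space of linear maps from `E` to `K`. -/
def prolongation (K : SecondLevelTableau E W) : Submodule ℝ (E →ₗ[ℝ] K) where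
  carrier := {f | ∀ x y z : E,
    (f x : E [⋀^Fin 2]→ₗ[ℝ] W) ![y, z] + (f y : E [⋀^Fin 2]→ₗ[ℝ] W) ![z, x]
      + (f z : E [⋀^Fin 2]→ₗ[ℝ] W) ![x, y] = 0}
  zero_mem' := by intro x y z; simp
  add_mem' := by
    intro f g hf hg x y z
    have h := congrArg₂ (· + ·) (hf x y z) (hg x y z)
    simp only [add_zero] at h
    rw [← h]
    simp only [LinearMap.add_apply, Submodule.coe_add, AlternatingMap.add_apply]
    abel
  smul_mem' := by
    intro c f hf x y z
    have h := congrArg (c • ·) (hf x y z)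
    simp only [smul_zero, smul_add] at h
    simpa only [LinearMap.smul_apply, Submodule.coe_smul, AlternatingMap.smul_apply] using h

/-- Involutivity: Cartan's test `dim K⁽¹⁾ = ∑ k s_k` holds. -/
def IsInvolutive (K : SecondLevelTableau E W) : Prop :=
  (Module.finrank ℝ K.prolongation : ℤ) =
    ∑ k ∈ Finset.range (Module.finrank ℝ E + 1), (k : ℤ) * cartanCharacter K k

variable (𝕜 : Type*) [Field 𝕜] [Algebra ℝ 𝕜]

/-- The extension of scalars `K ⊗ 𝕜`, inside the space of alternating forms on `E` with values
in `𝕜 ⊗ W`. -/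
def extendScalars (K : SecondLevelTableau E W) :
    Submodule 𝕜 (E [⋀^Fin 2]→ₗ[ℝ] (𝕜 ⊗[ℝ] W)) :=
  Submodule.span 𝕜 ((fun κ => (TensorProduct.mk ℝ 𝕜 W 1).compAlternatingMap κ) ''
    (K : Set (E [⋀^Fin 2]→ₗ[ℝ] W)))

/-- A covector `ξ ∈ E* ⊗ 𝕜` (a real-linear map `E → 𝕜`) is characteristic for `K` if `K ⊗ 𝕜`
contains a nonzero element of the form `ξ ∧ u` with `u ∈ W ⊗ E* ⊗ 𝕜`; for `ξ ≠ 0` this says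
that the restriction of `K ⊗ 𝕜` to the hyperplane `ξ = 0` of `E ⊗ 𝕜` is not injective. -/
def IsCharacteristic (K : SecondLevelTableau E W) (ξ : E →ₗ[ℝ] 𝕜) : Prop :=
  ∃ κ ∈ extendScalars 𝕜 K, κ ≠ 0 ∧
    ∃ u : E →ₗ[ℝ] (𝕜 ⊗[ℝ] W), ∀ x y : E, κ ![x, y] = ξ x • u y - ξ y • u x

/-- The set of `𝕜`-points of the characteristic variety, in `ℙ(E* ⊗ 𝕜)`. For `𝕜 = ℂ` this is
the (complex) characteristic variety and for `𝕜 = ℝ` it is the real one. -/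
def characteristicVariety (K : SecondLevelTableau E W) : Set (ℙ 𝕜 (E →ₗ[ℝ] 𝕜)) :=
  {p | IsCharacteristic 𝕜 K p.rep}

end SecondLevelTableau

end Tableau

/-! ## The degree of a projective variety -/

section Degree

variable {U : Type*} [AddCommGroup U] [Module ℂ U]

/-- The degree `t` part `(S / I(X))_t` of the homogeneous coordinate ring of `X ⊆ ℙ(U)`: the
space of all restrictions of homogeneous forms of degree `t` on `U` (the linear combinations of
products of `t` linear forms) to the cone over `X`. -/
def homogeneousCoordinatePart (X : Set (ℙ ℂ U)) (t : ℕ) :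
    Submodule ℂ ({v : U // ∃ h : v ≠ 0, Projectivization.mk ℂ v h ∈ X} → ℂ) :=
  Submodule.span ℂ
    (Set.range fun (ℓ : Fin t → Module.Dual ℂ U) v => ∏ i : Fin t, ℓ i (v : U))

/-- `X ⊆ ℙ(U)` has degree `d`: its Hilbert function `t ↦ dim (S / I(X))_t` is asymptotic to
`d tʳ / r!` for some `r` (the dimension of `X`), where `d > 0`. -/
def HasProjectiveDegree (X : Set (ℙ ℂ U)) (d : ℕ) : Prop :=
  0 < d ∧ ∃ r : ℕ, Filter.Tendsto
    (fun t : ℕ => (r.factorial : ℝ) * (Module.finrank ℂ (homogeneousCoordinatePart X t) : ℝ)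
      / (t : ℝ) ^ r)
    Filter.atTop (nhds (d : ℝ))

end Degree

/-! ## Curvature tensors of torsion-free `S¹·GL(n,ℝ)`-structures

Here `V = ℝⁿ`, and `V^ℂ = ℂⁿ` is regarded as a real vector space of dimension `2n`. -/

/-- The Lie algebra `𝔤 = ℝ·iI ⊕ 𝔤𝔩(n,ℝ)` of `S¹·GL(n,ℝ) ⊂ GL(n,ℂ) ⊂ GL(2n,ℝ)`, as a real
vector space of complex `n × n` matrices. -/
def circleGL (n : ℕ) : Submodule ℝ (Matrix (Fin n) (Fin n) ℂ) where
  carrier := {M | ∃ (t : ℝ) (A : Matrix (Fin n) (Fin n) ℝ),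
    M = ((t : ℂ) * Complex.I) • (1 : Matrix (Fin n) (Fin n) ℂ) + A.map (fun a : ℝ => (a : ℂ))}
  zero_mem' := ⟨0, 0, by ext i j; simp⟩
  add_mem' := by
    rintro _ _ ⟨t, A, rfl⟩ ⟨s, B, rfl⟩
    refine ⟨t + s, A + B, ?_⟩
    ext i j
    simp only [Matrix.add_apply, Matrix.smul_apply, Matrix.map_apply, smul_eq_mul]
    push_cast
    ring
  smul_mem' := by
    rintro c _ ⟨t, A, rfl⟩
    refine ⟨c * t, c • A, ?_⟩
    ext i j
    simp only [Matrix.add_apply, Matrix.smul_apply, Matrix.map_apply, smul_eq_mul,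
      Complex.real_smul]
    push_cast
    ring

/-- `𝒦(𝔤)`: the space of curvature tensors of torsion-free `𝔤`-connections, that is, the kernel
of the first Bianchi map `𝔤 ⊗ Λ²((V^ℂ)*) → V^ℂ ⊗ Λ³((V^ℂ)*)`. -/
def torsionFreeCurvature (n : ℕ) : SecondLevelTableau (Fin n → ℂ) (circleGL n) where
  carrier := {κ | ∀ x y z : Fin n → ℂ,
    (κ ![x, y] : Matrix (Fin n) (Fin n) ℂ).mulVec z
      + (κ ![y, z] : Matrix (Fin n) (Fin n) ℂ).mulVec x
      + (κ ![z, x] : Matrix (Fin n) (Fin n) ℂ).mulVec y = 0}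
  zero_mem' := by intro x y z; simp
  add_mem' := by
    intro κ μ hκ hμ x y z
    have h := congrArg₂ (· + ·) (hκ x y z) (hμ x y z)
    simp only [add_zero] at h
    rw [← h]
    simp only [AlternatingMap.add_apply, Submodule.coe_add, Matrix.add_mulVec]
    abel
  smul_mem' := by
    intro c κ hκ x y z
    have h := congrArg (c • ·) (hκ x y z)
    simp only [smul_zero, smul_add] at h
    simpa only [AlternatingMap.smul_apply, Submodule.coe_smul, Matrix.smul_mulVec] using h

/-- `𝒦_∘(𝔤)`: the curvature tensors of integrable torsion-free structures.

A torsion-free structure with connection form `i ω₀ I + φ` and tautological form `ζ` on the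
coframe bundle `F` is integrable (the circle `{e^{iθ}ℝⁿ}` of totally real `n`-planes at each
point consists of tangent planes of `n`-manifolds all of whose tangent planes are such
`n`-planes) exactly if the Pfaffian system `ω₀ = Im ζ = 0` on `F` is Frobenius, that is, if
`Ω₀ = dω₀` vanishes modulo `Im ζ` at each point of `F`. Since the fibers of `F` are orbits of
`S¹·GL(n,ℝ)` and `Ω₀` is invariant, the condition on the curvature `κ = i Ω₀ I + Φ` at one point
of the fiber is that `Ω₀` vanishes on all the planes `e^{iθ}ℝⁿ`, that is, that `κ` takes values
in the real matrices there. -/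
def integrableCurvature (n : ℕ) : SecondLevelTableau (Fin n → ℂ) (circleGL n) where
  carrier := {κ | κ ∈ torsionFreeCurvature n ∧
    ∀ (c : ℂ), ‖c‖ = 1 → ∀ (x y : Fin n → ℝ) (i j : Fin n),
      ((κ ![fun k => c * (x k : ℂ), fun k => c * (y k : ℂ)] :
        Matrix (Fin n) (Fin n) ℂ) i j).im = 0}
  zero_mem' := ⟨Submodule.zero_mem _, by intro c _ x y i j; simp⟩
  add_mem' := by
    rintro κ μ ⟨hκ, hκ'⟩ ⟨hμ, hμ'⟩
    refine ⟨Submodule.add_mem _ hκ hμ, fun c hc x y i j => ?_⟩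
    simp only [AlternatingMap.add_apply, Submodule.coe_add, Matrix.add_apply, Complex.add_im,
      hκ' c hc x y i j, hμ' c hc x y i j, add_zero]
  smul_mem' := by
    rintro a κ ⟨hκ, hκ'⟩
    refine ⟨Submodule.smul_mem _ a hκ, fun c hc x y i j => ?_⟩
    simp only [AlternatingMap.smul_apply, Submodule.coe_smul, Matrix.smul_apply, Complex.smul_im,
      hκ' c hc x y i j, smul_zero]

/-- For `l ∈ ℂ* ⊗ 𝕜` and `ξ' ∈ V* ⊗ 𝕜` (where `ℂ*` is the real dual), the covector `l ⊗ ξ'` on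
`ℂ ⊗ V = ℂⁿ`: it maps `z ⊗ v` to `l z * ξ' v`. -/
noncomputable def tensorCovector {𝕜 : Type*} [Field 𝕜] [Algebra ℝ 𝕜] {n : ℕ}
    (l : ℂ →ₗ[ℝ] 𝕜) (ξ' : (Fin n → ℝ) →ₗ[ℝ] 𝕜) : (Fin n → ℂ) →ₗ[ℝ] 𝕜 :=
  ∑ k : Fin n, ξ' (Pi.single k 1) • l.comp (LinearMap.proj k)

theorem tensorCovector_apply {𝕜 : Type*} [Field 𝕜] [Algebra ℝ 𝕜] {n : ℕ}
    (l : ℂ →ₗ[ℝ] 𝕜) (ξ' : (Fin n → ℝ) →ₗ[ℝ] 𝕜) (z : ℂ) (v : Fin n → ℝ) :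
    tensorCovector l ξ' (fun k => v k • z) = l z * ξ' v := by
  conv_rhs => rw [← LinearMap.sum_single_apply (fun _ => ℝ) v]
  simp only [tensorCovector, LinearMap.sum_apply, LinearMap.smul_apply, LinearMap.comp_apply,
    LinearMap.proj_apply, map_smul, map_sum, Finset.mul_sum, smul_eq_mul]
  refine Finset.sum_congr rfl fun k _ => ?_
  have h : (Pi.single k (v k) : Fin n → ℝ) = v k • (Pi.single k 1 : Fin n → ℝ) := by
    ext j
    by_cases hj : j = k
    · subst hj
      simp
    · simp [hj]
  rw [h, map_smul, Algebra.smul_def, Algebra.smul_def]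
  ring

/-- The points of `ℙ((ℂ ⊗ V)* ⊗ 𝕜)` that are represented by covectors of the form `l ⊗ ξ'`. -/
def decomposableCovectors (𝕜 : Type*) [Field 𝕜] [Algebra ℝ 𝕜] (n : ℕ) :
    Set (ℙ 𝕜 ((Fin n → ℂ) →ₗ[ℝ] 𝕜)) :=
  {p | ∃ (l : ℂ →ₗ[ℝ] 𝕜) (ξ' : (Fin n → ℝ) →ₗ[ℝ] 𝕜) (h : tensorCovector l ξ' ≠ 0),
    p = Projectivization.mk 𝕜 (tensorCovector l ξ') h}

/-!
Write vectors of `ℂⁿ` as `x = x' + i x''` with `x', x'' ∈ V = ℝⁿ`, and a curvature tensor as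
`κ = i Ω I + Φ`. Vanishing of `Ω` on all the planes `e^{iθ} ℝⁿ` means that
`Ω(x, y) = B(x', y'') - B(x'', y')` for a symmetric bilinear form `B` on `V`. The first Bianchi
identity then says that `Φ(u, i v) w` is totally symmetric in `u, v, w ∈ V` and that `B` determines
the rest of `Φ`. So `𝒦_∘(𝔤) ≅ S²(V*) ⊕ V ⊗ S³(V*)` (`curvForm`, `curvEquiv`), and everything is
computed with the components of such symmetric tensors, which are functions on `Sym (Fin n) d`.

*Prolongation.* In the same way the second Bianchi identity makes the tensors that describe an
element of the prolongation totally symmetric, up to a correction of the trilinear part by the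
derivative of `B`. Hence the prolongation is isomorphic to `ℝ² ⊗ (S³(V*) ⊕ V ⊗ S⁴(V*))`
(`range_prolongMap`).

*Cartan characters.* For `k ≤ n` the rank on the span of the vectors `(1 + i j) e_j`, `j < k`, is
counted directly: certain components of the restricted form can be prescribed
(`frameCoord_comp_surjective`), and they determine every form on that subspace that satisfies the
first Bianchi identity (`finrank_ker_frameBianchi_diagFrame_le`). Now let `e` be any `k`-frame and
`f` the diagonal one. For small `t` the rank on `e + t f` is at least that on `e`, and for all but
finitely many `t` the space of forms on `e + t f` satisfying the first Bianchi identity is no larger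
than that for `f`; so the rank on `f` is the maximal one (`finrank_map_formPullback_le`). The
diagonal frame with one more vector detects all of `𝒦_∘(𝔤)` (`eq_zero_of_curvComp_diag`), so there are no
characters beyond `s_{n+1}`. Cartan's test is then an identity between binomial coefficients.

*Characteristic variety.* A covector on `ℂⁿ = ℝ² ⊗ V` is a pair of covectors on `V`. If they are
independent, a product `ξ ∧ u` of the form `B ⊗ ε`, with `B` symmetric and `ε` the area form of
`ℝ²`, vanishes (`eq_zero_of_symm_wedge`). This kills first `Ω` and then `Φ`. If they are dependent, then
`ξ = l ⊗ ξ'`, and the tensor with `B = 0` and trilinear part `ξ'³ ⊗ e_0` is divisible by `ξ`.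

*Degree.* The decomposable covectors form the Segre variety `ℙ¹ × ℙⁿ⁻¹`. The restrictions of the
forms of degree `t ≥ 1` are the forms of bidegree `(t, t)`, so the Hilbert function is
`(t + 1) * (t + n - 1).choose (n - 1)`, which is asymptotic to `n tⁿ / n!`.
-/

open Module

/-! ### Symmetric tensors and polarization -/

section Polarization

variable {α : Type*}

/-- Functions on unordered tuples may be defined by specifying them on `i ::ₛ m`, compatibly with
the exchange of the first two entries. -/
theorem Sym.exists_eq_cons {W : Type*} {d : ℕ} (F : α → Sym α (d + 1) → W)
    (hF : ∀ i j m, F i (j ::ₛ m) = F j (i ::ₛ m)) :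
    ∃ s : Sym α (d + 2) → W, ∀ i m, s (i ::ₛ m) = F i m := by
  have h : ∀ M : Sym α (d + 2), ∃ (i : α) (m : Sym α (d + 1)), M = i ::ₛ m :=
    fun M => Sym.exists_eq_cons_of_succ M
  choose a r har using h
  refine ⟨fun M => F (a M) (r M), fun i m => ?_⟩
  have hM := har (i ::ₛ m)
  change F (a (i ::ₛ m)) (r (i ::ₛ m)) = F i m
  generalize a (i ::ₛ m) = j at hM ⊢
  generalize r (i ::ₛ m) = q at hM ⊢
  have hM' : i ::ₘ (m : Multiset α) = j ::ₘ (q : Multiset α) := by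
    rw [← Sym.coe_cons, ← Sym.coe_cons, hM]
  rcases Multiset.cons_eq_cons.1 hM' with ⟨rfl, hmq⟩ | ⟨-, c, hm, hq⟩
  · rw [Sym.coe_injective hmq]
  · have hc : Multiset.card c = d := by
      have := congrArg Multiset.card hm
      simp only [Multiset.card_cons, Sym.card_coe] at this
      omega
    obtain ⟨c, rfl⟩ : ∃ c' : Sym α d, c = c' := ⟨Sym.mk c hc, rfl⟩
    have hm' : m = j ::ₛ c := Sym.coe_injective hm
    have hq' : q = i ::ₛ c := Sym.coe_injective hq
    rw [hm', hq']
    exact hF j i _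

variable {n : ℕ}

/-- The contraction of a symmetric tensor with a vector. A symmetric `d`-linear form on `ℝⁿ` is
encoded by its components, a function on the unordered `d`-tuples of indices. -/
def contract {d : ℕ} :
    (Fin n → ℝ) →ₗ[ℝ] (Sym (Fin n) (d + 1) → ℝ) →ₗ[ℝ] (Sym (Fin n) d → ℝ) :=
  LinearMap.mk₂ ℝ (fun x h m => ∑ i, x i * h (i ::ₛ m))
    (by intro x y h; ext m; simp [add_mul, Finset.sum_add_distrib])
    (by intro c x h; ext m; simp [Finset.mul_sum, mul_assoc])
    (by intro x h k; ext m; simp [mul_add, Finset.sum_add_distrib])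
    (by intro c x h; ext m; simp [Finset.mul_sum, mul_left_comm])

theorem contract_apply {d : ℕ} (x : Fin n → ℝ) (h : Sym (Fin n) (d + 1) → ℝ) (m : Sym (Fin n) d) :
    contract x h m = ∑ i, x i * h (i ::ₛ m) := rfl

theorem contract_single {d : ℕ} (i : Fin n) (h : Sym (Fin n) (d + 1) → ℝ) (m : Sym (Fin n) d) :
    contract (Pi.single i 1) h m = h (i ::ₛ m) := by
  rw [contract_apply, Finset.sum_eq_single i] <;> simp +contextual

theorem contract_comm {d : ℕ} (x y : Fin n → ℝ) (h : Sym (Fin n) (d + 2) → ℝ) :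
    contract x (contract y h) = contract y (contract x h) := by
  ext m
  simp only [contract_apply, Finset.mul_sum]
  rw [Finset.sum_comm]
  refine Finset.sum_congr rfl fun i _ => Finset.sum_congr rfl fun j _ => ?_
  rw [Sym.cons_swap]
  ring

/-- The value of a symmetric bilinear form at a pair of vectors. -/
def bil (b : Sym (Fin n) 2 → ℝ) (x y : Fin n → ℝ) : ℝ := contract x (contract y b) Sym.nil

/-- The value of a symmetric trilinear form at a triple of vectors. -/
def tril (s : Sym (Fin n) 3 → ℝ) (x y z : Fin n → ℝ) : ℝ :=
  contract x (contract y (contract z s)) Sym.nil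

theorem bil_single (b : Sym (Fin n) 2 → ℝ) (i j : Fin n) :
    bil b (Pi.single i 1) (Pi.single j 1) = b (i ::ₛ j ::ₛ Sym.nil) := by
  rw [bil, contract_single, contract_single, Sym.cons_swap]

theorem tril_single (s : Sym (Fin n) 3 → ℝ) (i j l : Fin n) :
    tril s (Pi.single i 1) (Pi.single j 1) (Pi.single l 1) = s (i ::ₛ j ::ₛ l ::ₛ Sym.nil) := by
  rw [tril, contract_single, contract_single, contract_single, Sym.cons_swap j i, Sym.cons_swap l i,
    Sym.cons_swap l j]

theorem bil_comm (b : Sym (Fin n) 2 → ℝ) (x y : Fin n → ℝ) : bil b x y = bil b y x := by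
  rw [bil, contract_comm, ← bil]

theorem tril_swap_left (s : Sym (Fin n) 3 → ℝ) (x y z : Fin n → ℝ) :
    tril s x y z = tril s y x z := by
  rw [tril, contract_comm, ← tril]

theorem tril_swap_right (s : Sym (Fin n) 3 → ℝ) (x y z : Fin n → ℝ) :
    tril s x y z = tril s x z y := by
  rw [tril, contract_comm y z, ← tril]

theorem bil_sum_left (b : Sym (Fin n) 2 → ℝ) (x z : Fin n → ℝ) :
    ∑ l, bil b x (Pi.single l 1) * z l = bil b x z := by
  simp only [bil_comm b x]
  simp only [bil, contract_single]
  rw [contract_apply]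
  exact Finset.sum_congr rfl fun l _ => mul_comm _ _

theorem tril_sum_left (s : Sym (Fin n) 3 → ℝ) (x y z : Fin n → ℝ) :
    ∑ l, tril s x y (Pi.single l 1) * z l = tril s x y z := by
  simp only [tril_swap_right s x y, tril_swap_left s x]
  simp only [tril, contract_single]
  rw [contract_apply]
  exact Finset.sum_congr rfl fun l _ => mul_comm _ _

theorem Sym.two_cases {P : Sym α 2 → Prop} (h : ∀ i j, P (i ::ₛ j ::ₛ Sym.nil)) (m : Sym α 2) :
    P m := by
  obtain ⟨i, m, rfl⟩ := Sym.exists_eq_cons_of_succ m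
  obtain ⟨j, m, rfl⟩ := Sym.exists_eq_cons_of_succ m
  rw [Sym.eq_nil_of_card_zero m]
  exact h i j

theorem Sym.three_cases {P : Sym α 3 → Prop} (h : ∀ i j l, P (i ::ₛ j ::ₛ l ::ₛ Sym.nil))
    (m : Sym α 3) : P m := by
  obtain ⟨i, m, rfl⟩ := Sym.exists_eq_cons_of_succ m
  obtain ⟨j, m, rfl⟩ := Sym.exists_eq_cons_of_succ m
  obtain ⟨l, m, rfl⟩ := Sym.exists_eq_cons_of_succ m
  rw [Sym.eq_nil_of_card_zero m]
  exact h i j l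

/-- A symmetric array of components is given by a function on unordered pairs. -/
theorem Sym.exists_two {W : Type*} (F : α → α → W) (hF : ∀ i j, F i j = F j i) :
    ∃ s : Sym α 2 → W, ∀ i j, s (i ::ₛ j ::ₛ Sym.nil) = F i j := by
  have h1 : ∀ i, ∃ s : Sym α 1 → W, ∀ j, s (j ::ₛ Sym.nil) = F i j := by
    intro i
    have h : ∀ M : Sym α 1, ∃ j : α, M = j ::ₛ Sym.nil := by
      intro M
      obtain ⟨j, m, rfl⟩ := Sym.exists_eq_cons_of_succ M
      exact ⟨j, by rw [Sym.eq_nil_of_card_zero m]⟩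
    choose a ha using h
    refine ⟨fun M => F i (a M), fun j => ?_⟩
    have h2 := ha (j ::ₛ Sym.nil)
    have : j = a (j ::ₛ Sym.nil) := by
      have h3 := congrArg (fun s : Sym α 1 => (s : Multiset α)) h2
      simpa using h3
    exact congrArg (F i) this.symm
  choose s hs using h1
  obtain ⟨S, hS⟩ := Sym.exists_eq_cons s (by
    intro i j m
    rw [Sym.eq_nil_of_card_zero m, hs, hs, hF])
  exact ⟨S, fun i j => by rw [hS, hs]⟩

/-- A totally symmetric array of components is given by a function on unordered triples. -/
theorem Sym.exists_three {W : Type*} (F : α → α → α → W) (hF : ∀ i j l, F i j l = F j i l)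
    (hF' : ∀ i j l, F i j l = F i l j) :
    ∃ s : Sym α 3 → W, ∀ i j l, s (i ::ₛ j ::ₛ l ::ₛ Sym.nil) = F i j l := by
  choose s hs using fun i => Sym.exists_two (F i) (hF' i)
  obtain ⟨S, hS⟩ := Sym.exists_eq_cons s (by
    intro i j m
    obtain ⟨l, m, rfl⟩ := Sym.exists_eq_cons_of_succ m
    rw [Sym.eq_nil_of_card_zero m, hs, hs, hF])
  exact ⟨S, fun i j l => by rw [hS, hs]⟩

end Polarization

/-! ### Alternating maps on `ℂⁿ` -/

section Alternating

variable {E W : Type*} [AddCommGroup E] [Module ℝ E] [AddCommGroup W] [Module ℝ W] {n : ℕ}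

theorem AlternatingMap.pair_ext {f g : E [⋀^Fin 2]→ₗ[ℝ] W} (h : ∀ x y, f ![x, y] = g ![x, y]) :
    f = g := by
  ext v
  have hv : v = ![v 0, v 1] := by ext i; fin_cases i <;> rfl
  rw [hv]
  exact h _ _

theorem AlternatingMap.pair_swap (f : E [⋀^Fin 2]→ₗ[ℝ] W) (x y : E) :
    f ![x, y] = - f ![y, x] := by
  have h := f.map_swap ![y, x] (i := 0) (j := 1) (by decide)
  rw [← h]
  congr 1
  ext i
  fin_cases i <;> rfl

theorem AlternatingMap.pair_self (f : E [⋀^Fin 2]→ₗ[ℝ] W) (x : E) : f ![x, x] = 0 :=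
  f.map_eq_zero_of_eq ![x, x] (i := 0) (j := 1) rfl (by decide)

/-- An alternating form of degree two as a bilinear map. -/
def AlternatingMap.toBilin (f : E [⋀^Fin 2]→ₗ[ℝ] W) : E →ₗ[ℝ] E →ₗ[ℝ] W :=
  LinearMap.mk₂ ℝ (fun x y => f ![x, y])
    (fun x y z => f.toMultilinearMap.cons_add ![z] x y)
    (fun c x y => f.toMultilinearMap.cons_smul ![y] c x)
    (fun x y z => by
      have h := f.toMultilinearMap.cons_add ![x] y z
      have e := AlternatingMap.pair_swap f
      change f ![x, y + z] = _
      rw [e x (y + z), e x y, e x z, ← neg_add]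
      exact congrArg Neg.neg h)
    (fun c x y => by
      have h := f.toMultilinearMap.cons_smul ![x] c y
      have e := AlternatingMap.pair_swap f
      change f ![x, c • y] = _
      rw [e x (c • y), e x y, smul_neg]
      exact congrArg Neg.neg h)

theorem AlternatingMap.toBilin_apply (f : E [⋀^Fin 2]→ₗ[ℝ] W) (x y : E) :
    AlternatingMap.toBilin f x y = f ![x, y] := rfl

/-- The alternating form of degree two defined by an alternating bilinear map. -/
def alternatingOfBilin (β : E →ₗ[ℝ] E →ₗ[ℝ] W) (h : ∀ x, β x x = 0) : E [⋀^Fin 2]→ₗ[ℝ] W :=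
  { MultilinearMap.mk' (fun m : Fin 2 → E => β (m 0) (m 1))
      (fun m i x y => by fin_cases i <;> simp)
      (fun m i c x => by fin_cases i <;> simp) with
    map_eq_zero_of_eq' := fun v i j hij hne => by
      change β (v 0) (v 1) = 0
      fin_cases i <;> fin_cases j <;> simp_all }

theorem alternatingOfBilin_apply (β : E →ₗ[ℝ] E →ₗ[ℝ] W) (h : ∀ x, β x x = 0) (x y : E) :
    alternatingOfBilin β h ![x, y] = β x y := rfl

instance AlternatingMap.finite_pair [Module.Finite ℝ E] [Module.Finite ℝ W] :
    Module.Finite ℝ (E [⋀^Fin 2]→ₗ[ℝ] W) :=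
  Module.Finite.of_injective
    ({ toFun := AlternatingMap.toMultilinearMap
       map_add' := fun _ _ => rfl
       map_smul' := fun _ _ => rfl } :
      (E [⋀^Fin 2]→ₗ[ℝ] W) →ₗ[ℝ] MultilinearMap ℝ (fun _ : Fin 2 => E) W)
    AlternatingMap.coe_multilinearMap_injective

/-- The basis vector `e_i` of `ℂⁿ`. -/
def reVec (i : Fin n) : Fin n → ℂ := Pi.single i 1

/-- The vector `i e_i` of `ℂⁿ`. -/
def imVec (i : Fin n) : Fin n → ℂ := Pi.single i Complex.I

/-- The vectors `e_i` and `i e_i` as a real basis of `ℂⁿ`. -/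
noncomputable def realBasis (n : ℕ) : Basis ((_ : Fin n) × Fin 2) ℝ (Fin n → ℂ) :=
  Pi.basis fun _ => Complex.basisOneI

theorem realBasis_zero (i : Fin n) : realBasis n ⟨i, 0⟩ = reVec i := by
  simp [realBasis, reVec, Pi.basis_apply]

theorem realBasis_one (i : Fin n) : realBasis n ⟨i, 1⟩ = imVec i := by
  simp [realBasis, imVec, Pi.basis_apply]

theorem LinearMap.ext_realBasis {f g : (Fin n → ℂ) →ₗ[ℝ] W} (h₁ : ∀ i, f (reVec i) = g (reVec i))
    (h₂ : ∀ i, f (imVec i) = g (imVec i)) : f = g := by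
  refine (realBasis n).ext fun ⟨i, a⟩ => ?_
  fin_cases a
  · simpa [realBasis_zero] using h₁ i
  · simpa [realBasis_one] using h₂ i

theorem AlternatingMap.ext_realBasis {f g : (Fin n → ℂ) [⋀^Fin 2]→ₗ[ℝ] W}
    (h₁ : ∀ i j, f ![reVec i, reVec j] = g ![reVec i, reVec j])
    (h₂ : ∀ i j, f ![reVec i, imVec j] = g ![reVec i, imVec j])
    (h₃ : ∀ i j, f ![imVec i, imVec j] = g ![imVec i, imVec j]) : f = g := by
  have h : AlternatingMap.toBilin f = AlternatingMap.toBilin g := by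
    refine LinearMap.ext_realBasis (fun i => LinearMap.ext_realBasis (h₁ i) (h₂ i))
      (fun i => LinearMap.ext_realBasis (fun j => ?_) (h₃ i))
    simp only [AlternatingMap.toBilin_apply]
    rw [AlternatingMap.pair_swap f, AlternatingMap.pair_swap g, h₂]
  exact AlternatingMap.pair_ext fun x y => LinearMap.congr_fun (LinearMap.congr_fun h x) y

end Alternating

/-! ### The Lie algebra in coordinates -/

section CircleGL

variable {n : ℕ}

/-- The real part of a vector of `ℂⁿ`. -/
def reL (n : ℕ) : (Fin n → ℂ) →ₗ[ℝ] (Fin n → ℝ) := LinearMap.compLeft Complex.reLm (Fin n)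

/-- The imaginary part of a vector of `ℂⁿ`. -/
def imL (n : ℕ) : (Fin n → ℂ) →ₗ[ℝ] (Fin n → ℝ) := LinearMap.compLeft Complex.imLm (Fin n)

theorem reL_apply (x : Fin n → ℂ) (i : Fin n) : reL n x i = (x i).re := rfl

theorem imL_apply (x : Fin n → ℂ) (i : Fin n) : imL n x i = (x i).im := rfl

@[simp] theorem reL_reVec (i : Fin n) : reL n (reVec i) = Pi.single i 1 := by
  ext j; rw [reL_apply, reVec, Pi.single_apply, Pi.single_apply]; split_ifs <;> simp

@[simp] theorem imL_reVec (i : Fin n) : imL n (reVec i) = 0 := by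
  ext j; rw [imL_apply, reVec, Pi.single_apply]; split_ifs <;> simp

@[simp] theorem reL_imVec (i : Fin n) : reL n (imVec i) = 0 := by
  ext j; rw [reL_apply, imVec, Pi.single_apply]; split_ifs <;> simp

@[simp] theorem imL_imVec (i : Fin n) : imL n (imVec i) = Pi.single i 1 := by
  ext j; rw [imL_apply, imVec, Pi.single_apply, Pi.single_apply]; split_ifs <;> simp

/-- The isomorphism `𝔤 ≃ ℝ × ℝ^(n × n)` taking `i t I + A` to `(t, A)`. The
components are indexed by `Option (Fin n × Fin n)`, with `none` standing for the component `t`. -/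
noncomputable def circleGLEquiv (n : ℕ) [NeZero n] :
    circleGL n ≃ₗ[ℝ] (Option (Fin n × Fin n) → ℝ) where
  toFun M o := o.elim ((M : Matrix (Fin n) (Fin n) ℂ) 0 0).im
    fun p => ((M : Matrix (Fin n) (Fin n) ℂ) p.1 p.2).re
  map_add' M N := by ext (_ | p) <;> simp
  map_smul' c M := by ext (_ | p) <;> simp
  invFun v := ⟨((v none : ℂ) * Complex.I) • (1 : Matrix (Fin n) (Fin n) ℂ)
      + (Matrix.of fun i j => v (some (i, j))).map (fun a : ℝ => (a : ℂ)), v none, _, rfl⟩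
  left_inv := by
    rintro ⟨_, t, A, rfl⟩
    refine Subtype.ext (Matrix.ext fun i j => ?_)
    by_cases h : i = j <;> simp [h, Matrix.one_apply]
  right_inv v := by
    ext (_ | ⟨i, j⟩)
    · simp
    · by_cases h : i = j <;> simp [h, Matrix.one_apply]

theorem circleGLEquiv_entry_re [NeZero n] (M : circleGL n) (i j : Fin n) :
    ((M : Matrix (Fin n) (Fin n) ℂ) i j).re = circleGLEquiv n M (some (i, j)) := rfl

theorem circleGLEquiv_entry_im [NeZero n] (M : circleGL n) (i j : Fin n) :
    ((M : Matrix (Fin n) (Fin n) ℂ) i j).im = if i = j then circleGLEquiv n M none else 0 := by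
  obtain ⟨_, t, A, rfl⟩ := M
  by_cases h : i = j <;> simp [h, Matrix.one_apply, circleGLEquiv]

theorem circleGL_mulVec_re [NeZero n] (M : circleGL n) (z : Fin n → ℂ) (i : Fin n) :
    ((M : Matrix (Fin n) (Fin n) ℂ).mulVec z i).re =
      ∑ l, circleGLEquiv n M (some (i, l)) * reL n z l - circleGLEquiv n M none * imL n z i := by
  simp only [Matrix.mulVec, dotProduct, Complex.re_sum, Complex.mul_re, circleGLEquiv_entry_re,
    circleGLEquiv_entry_im, Finset.sum_sub_distrib, ite_mul, zero_mul, Finset.sum_ite_eq,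
    Finset.mem_univ, if_true, reL_apply, imL_apply]

theorem circleGL_mulVec_im [NeZero n] (M : circleGL n) (z : Fin n → ℂ) (i : Fin n) :
    ((M : Matrix (Fin n) (Fin n) ℂ).mulVec z i).im =
      ∑ l, circleGLEquiv n M (some (i, l)) * imL n z l + circleGLEquiv n M none * reL n z i := by
  simp only [Matrix.mulVec, dotProduct, Complex.im_sum, Complex.mul_im, circleGLEquiv_entry_re,
    circleGLEquiv_entry_im, Finset.sum_add_distrib, ite_mul, zero_mul, Finset.sum_ite_eq,
    Finset.mem_univ, if_true, reL_apply, imL_apply]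

end CircleGL

/-! ### Curvature tensors in terms of symmetric tensors -/

section Curvature

variable {n : ℕ}

/-- The space `S²(V*) ⊕ V ⊗ S³(V*)`, in components. -/
abbrev SymPair (n : ℕ) : Type := (Sym (Fin n) 2 → ℝ) × (Fin n → Sym (Fin n) 3 → ℝ)

/-- The components of the curvature `i Ω I + Φ` defined by a symmetric bilinear form `B` and a
`V`-valued symmetric trilinear form `S`: writing `x = x' + i x''` and `y = y' + i y''`,
`Ω(x, y) = B(x', y'') - B(x'', y')` and
`Φ(x, y) z = S(x', y'', z) - S(x'', y', z)
  + B(x', z) y' - B(y', z) x' + B(x'', z) y'' - B(y'', z) x''`. -/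
noncomputable def curvComp (p : SymPair n) (x y : Fin n → ℂ) : Option (Fin n × Fin n) → ℝ
  | none => bil p.1 (reL n x) (imL n y) - bil p.1 (imL n x) (reL n y)
  | some (m, l) =>
      tril (p.2 m) (reL n x) (imL n y) (Pi.single l 1)
        - tril (p.2 m) (imL n x) (reL n y) (Pi.single l 1)
      + bil p.1 (reL n x) (Pi.single l 1) * reL n y m
      - bil p.1 (reL n y) (Pi.single l 1) * reL n x m
      + bil p.1 (imL n x) (Pi.single l 1) * imL n y m
      - bil p.1 (imL n y) (Pi.single l 1) * imL n x m

theorem curvComp_none (p : SymPair n) (x y : Fin n → ℂ) :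
    curvComp p x y none = bil p.1 (reL n x) (imL n y) - bil p.1 (imL n x) (reL n y) := rfl

theorem curvComp_add_left (p : SymPair n) (x x' y : Fin n → ℂ) :
    curvComp p (x + x') y = curvComp p x y + curvComp p x' y := by
  ext (_ | ⟨m, l⟩) <;> simp [curvComp, bil, tril] <;> ring

theorem curvComp_smul_left (p : SymPair n) (c : ℝ) (x y : Fin n → ℂ) :
    curvComp p (c • x) y = c • curvComp p x y := by
  ext (_ | ⟨m, l⟩) <;> simp [curvComp, bil, tril] <;> ring

theorem curvComp_swap (p : SymPair n) (x y : Fin n → ℂ) :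
    curvComp p x y = - curvComp p y x := by
  ext (_ | ⟨m, l⟩)
  · simp only [curvComp, Pi.neg_apply, bil_comm _ (reL n x), bil_comm _ (imL n x)]
    ring
  · simp only [curvComp, Pi.neg_apply, tril_swap_left _ (reL n x), tril_swap_left _ (imL n x)]
    ring

theorem curvComp_add_right (p : SymPair n) (x y y' : Fin n → ℂ) :
    curvComp p x (y + y') = curvComp p x y + curvComp p x y' := by
  rw [curvComp_swap, curvComp_add_left, neg_add, ← curvComp_swap, ← curvComp_swap]

theorem curvComp_smul_right (p : SymPair n) (c : ℝ) (x y : Fin n → ℂ) :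
    curvComp p x (c • y) = c • curvComp p x y := by
  rw [curvComp_swap, curvComp_smul_left, ← smul_neg, ← curvComp_swap]

theorem curvComp_self (p : SymPair n) (x : Fin n → ℂ) : curvComp p x x = 0 :=
  self_eq_neg.1 (curvComp_swap p x x)

theorem curvComp_add (p q : SymPair n) (x y : Fin n → ℂ) :
    curvComp (p + q) x y = curvComp p x y + curvComp q x y := by
  ext (_ | ⟨m, l⟩) <;> simp [curvComp, bil, tril] <;> ring

theorem curvComp_smul (c : ℝ) (p : SymPair n) (x y : Fin n → ℂ) :
    curvComp (c • p) x y = c • curvComp p x y := by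
  ext (_ | ⟨m, l⟩) <;> simp [curvComp, bil, tril] <;> ring

/-- Contracting the `𝔤𝔩(n,ℝ)`-part of the curvature with a vector. -/
theorem sum_curvComp_mul (p : SymPair n) (x y : Fin n → ℂ) (w : Fin n → ℝ) (m : Fin n) :
    ∑ l, curvComp p x y (some (m, l)) * w l =
      tril (p.2 m) (reL n x) (imL n y) w - tril (p.2 m) (imL n x) (reL n y) w
      + bil p.1 (reL n x) w * reL n y m - bil p.1 (reL n y) w * reL n x m
      + bil p.1 (imL n x) w * imL n y m - bil p.1 (imL n y) w * imL n x m := by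
  simp only [← tril_sum_left _ _ _ w, ← bil_sum_left _ _ w, Finset.sum_mul,
    ← Finset.sum_add_distrib, ← Finset.sum_sub_distrib]
  refine Finset.sum_congr rfl fun l _ => ?_
  rw [curvComp]
  ring

variable [NeZero n]

/-- The curvature tensor with the components `curvComp`, defined by a pair of symmetric tensors. -/
noncomputable def curvForm (n : ℕ) [NeZero n] :
    SymPair n →ₗ[ℝ] (Fin n → ℂ) [⋀^Fin 2]→ₗ[ℝ] circleGL n where
  toFun p := (circleGLEquiv n).symm.toLinearMap.compAlternatingMap <|
    alternatingOfBilin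
      (LinearMap.mk₂ ℝ (curvComp p) (curvComp_add_left p) (curvComp_smul_left p)
        (curvComp_add_right p) fun c => curvComp_smul_right p c)
      (curvComp_self p)
  map_add' p q := AlternatingMap.pair_ext fun x y => by
    change (circleGLEquiv n).symm (curvComp (p + q) x y) =
      (circleGLEquiv n).symm (curvComp p x y) + (circleGLEquiv n).symm (curvComp q x y)
    rw [← map_add, curvComp_add]
  map_smul' c p := AlternatingMap.pair_ext fun x y => by
    change (circleGLEquiv n).symm (curvComp (c • p) x y) =
      c • (circleGLEquiv n).symm (curvComp p x y)
    rw [← map_smul, curvComp_smul]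

/-- The components of the values of a form with values in `𝔤`. -/
noncomputable def component {E : Type*} [AddCommGroup E] [Module ℝ E]
    (κ : E [⋀^Fin 2]→ₗ[ℝ] circleGL n) (o : Option (Fin n × Fin n)) (x y : E) : ℝ :=
  circleGLEquiv n (κ ![x, y]) o

theorem component_curvForm (p : SymPair n) (o : Option (Fin n × Fin n)) (x y : Fin n → ℂ) :
    component (curvForm n p) o x y = curvComp p x y o := by
  change circleGLEquiv n ((circleGLEquiv n).symm (curvComp p x y)) o = _
  rw [LinearEquiv.apply_symm_apply]

theorem component_swap {E : Type*} [AddCommGroup E] [Module ℝ E]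
    (κ : E [⋀^Fin 2]→ₗ[ℝ] circleGL n) (o : Option (Fin n × Fin n)) (x y : E) :
    component κ o x y = - component κ o y x := by
  rw [component, AlternatingMap.pair_swap, map_neg]; rfl

theorem ext_component {κ μ : (Fin n → ℂ) [⋀^Fin 2]→ₗ[ℝ] circleGL n}
    (h₁ : ∀ o i j, component κ o (reVec i) (reVec j) = component μ o (reVec i) (reVec j))
    (h₂ : ∀ o i j, component κ o (reVec i) (imVec j) = component μ o (reVec i) (imVec j))
    (h₃ : ∀ o i j, component κ o (imVec i) (imVec j) = component μ o (imVec i) (imVec j)) :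
    κ = μ :=
  AlternatingMap.ext_realBasis
    (fun i j => (circleGLEquiv n).injective (funext fun o => h₁ o i j))
    (fun i j => (circleGLEquiv n).injective (funext fun o => h₂ o i j))
    (fun i j => (circleGLEquiv n).injective (funext fun o => h₃ o i j))

theorem curvForm_mem (p : SymPair n) : curvForm n p ∈ integrableCurvature n := by
  refine ⟨fun x y z => ?_, fun c hc x y i j => ?_⟩
  · have key : ∀ (x y z : Fin n → ℂ) (m : Fin n),
        (((curvForm n p ![x, y] : Matrix (Fin n) (Fin n) ℂ).mulVec z m).re =
          ∑ l, curvComp p x y (some (m, l)) * reL n z l - curvComp p x y none * imL n z m) ∧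
        (((curvForm n p ![x, y] : Matrix (Fin n) (Fin n) ℂ).mulVec z m).im =
          ∑ l, curvComp p x y (some (m, l)) * imL n z l + curvComp p x y none * reL n z m) := by
      intro x y z m
      rw [circleGL_mulVec_re, circleGL_mulVec_im]
      have h := component_curvForm p
      simp only [component] at h
      simp only [h, and_self]
    have cyc : ∀ (s : Sym (Fin n) 3 → ℝ) (u v w : Fin n → ℝ), tril s u v w = tril s v w u :=
      fun s u v w => by rw [tril_swap_left, tril_swap_right]
    ext m
    apply Complex.ext
    · simp only [Pi.add_apply, Complex.add_re, (key _ _ _ _).1, sum_curvComp_mul, curvComp_none,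
        Pi.zero_apply, Complex.zero_re]
      rw [cyc _ (reL n x) (imL n y), cyc _ (reL n z) (imL n x), cyc _ (reL n y) (imL n z),
        bil_comm _ (reL n z) (reL n x), bil_comm _ (imL n z) (reL n x),
        bil_comm _ (reL n z) (imL n x), bil_comm _ (reL n y) (reL n x),
        bil_comm _ (imL n y) (reL n x), bil_comm _ (reL n z) (reL n y),
        bil_comm _ (imL n z) (reL n y)]
      ring
    · simp only [Pi.add_apply, Complex.add_im, (key _ _ _ _).2, sum_curvComp_mul, curvComp_none,
        Pi.zero_apply, Complex.zero_im]
      rw [cyc _ (imL n x) (reL n y), cyc _ (imL n z) (reL n x), cyc _ (imL n y) (reL n z),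
        bil_comm _ (reL n z) (imL n x), bil_comm _ (imL n z) (reL n x),
        bil_comm _ (imL n z) (imL n x), bil_comm _ (imL n y) (imL n x),
        bil_comm _ (reL n y) (imL n x), bil_comm _ (imL n z) (imL n y),
        bil_comm _ (reL n z) (imL n y)]
      ring
  · rw [circleGLEquiv_entry_im]
    split_ifs
    · have h := component_curvForm p none
      simp only [component] at h
      rw [h]
      have h1 : ∀ x : Fin n → ℝ, reL n (fun k => c * (x k : ℂ)) = c.re • x := by
        intro x; ext i; simp [reL_apply]
      have h2 : ∀ x : Fin n → ℝ, imL n (fun k => c * (x k : ℂ)) = c.im • x := by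
        intro x; ext i; simp [imL_apply]
      simp only [curvComp, h1, h2, bil, map_smul, LinearMap.smul_apply, Pi.smul_apply, smul_eq_mul]
      ring
    · rfl

omit [NeZero n] in
theorem curvComp_reVec_reVec_none (p : SymPair n) (i j : Fin n) :
    curvComp p (reVec i) (reVec j) none = 0 := by simp [curvComp, bil]

omit [NeZero n] in
theorem curvComp_imVec_imVec_none (p : SymPair n) (i j : Fin n) :
    curvComp p (imVec i) (imVec j) none = 0 := by simp [curvComp, bil]

omit [NeZero n] in
theorem curvComp_reVec_imVec_none (p : SymPair n) (i j : Fin n) :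
    curvComp p (reVec i) (imVec j) none = p.1 (i ::ₛ j ::ₛ Sym.nil) := by
  rw [← bil_single p.1]; simp [curvComp, bil]

omit [NeZero n] in
theorem curvComp_reVec_reVec_some (p : SymPair n) (i j m l : Fin n) :
    curvComp p (reVec i) (reVec j) (some (m, l)) =
      p.1 (i ::ₛ l ::ₛ Sym.nil) * (Pi.single j 1 : Fin n → ℝ) m
        - p.1 (j ::ₛ l ::ₛ Sym.nil) * (Pi.single i 1 : Fin n → ℝ) m := by
  rw [← bil_single p.1, ← bil_single p.1]; simp [curvComp, bil, tril]

omit [NeZero n] in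
theorem curvComp_imVec_imVec_some (p : SymPair n) (i j m l : Fin n) :
    curvComp p (imVec i) (imVec j) (some (m, l)) =
      p.1 (i ::ₛ l ::ₛ Sym.nil) * (Pi.single j 1 : Fin n → ℝ) m
        - p.1 (j ::ₛ l ::ₛ Sym.nil) * (Pi.single i 1 : Fin n → ℝ) m := by
  rw [← bil_single p.1, ← bil_single p.1]; simp [curvComp, bil, tril]

omit [NeZero n] in
theorem curvComp_reVec_imVec_some (p : SymPair n) (i j m l : Fin n) :
    curvComp p (reVec i) (imVec j) (some (m, l)) = p.2 m (i ::ₛ j ::ₛ l ::ₛ Sym.nil) := by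
  rw [← tril_single (p.2 m)]; simp [curvComp, bil, tril]

theorem curvForm_injective : Function.Injective (curvForm n) := by
  refine (injective_iff_map_eq_zero _).2 fun p hp => ?_
  have h : ∀ o x y, curvComp p x y o = 0 := fun o x y => by
    rw [← component_curvForm, hp, component]; simp
  refine Prod.ext (funext <| Sym.two_cases fun i j => ?_)
    (funext fun m => funext <| Sym.three_cases fun i j l => ?_)
  · rw [← curvComp_reVec_imVec_none, h]; rfl
  · rw [← curvComp_reVec_imVec_some, h]; rfl

/-- The real part of the first Bianchi identity. -/
theorem bianchi_re {κ : (Fin n → ℂ) [⋀^Fin 2]→ₗ[ℝ] circleGL n} (hκ : κ ∈ torsionFreeCurvature n)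
    (x y z : Fin n → ℂ) (m : Fin n) :
    (∑ l, component κ (some (m, l)) x y * reL n z l - component κ none x y * imL n z m)
      + (∑ l, component κ (some (m, l)) y z * reL n x l - component κ none y z * imL n x m)
      + (∑ l, component κ (some (m, l)) z x * reL n y l - component κ none z x * imL n y m)
      = 0 := by
  have h := congrArg Complex.re (congrFun (hκ x y z) m)
  simpa only [Pi.add_apply, Complex.add_re, circleGL_mulVec_re, Pi.zero_apply, Complex.zero_re,
    component] using h

/-- The imaginary part of the first Bianchi identity. -/
theorem bianchi_im {κ : (Fin n → ℂ) [⋀^Fin 2]→ₗ[ℝ] circleGL n} (hκ : κ ∈ torsionFreeCurvature n)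
    (x y z : Fin n → ℂ) (m : Fin n) :
    (∑ l, component κ (some (m, l)) x y * imL n z l + component κ none x y * reL n z m)
      + (∑ l, component κ (some (m, l)) y z * imL n x l + component κ none y z * reL n x m)
      + (∑ l, component κ (some (m, l)) z x * imL n y l + component κ none z x * reL n y m)
      = 0 := by
  have h := congrArg Complex.im (congrFun (hκ x y z) m)
  simpa only [Pi.add_apply, Complex.add_im, circleGL_mulVec_im, Pi.zero_apply, Complex.zero_im,
    component] using h

/-- The integrability condition, for the vectors `c e_i` and `c e_j`. -/
theorem component_none_eq_zero {κ : (Fin n → ℂ) [⋀^Fin 2]→ₗ[ℝ] circleGL n}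
    (hκ : κ ∈ integrableCurvature n) (c : ℂ) (hc : ‖c‖ = 1) (i j : Fin n) :
    component κ none (c.re • reVec i + c.im • imVec i) (c.re • reVec j + c.im • imVec j) = 0 := by
  have h := hκ.2 c hc (Pi.single i 1) (Pi.single j 1) 0 0
  have e : ∀ i : Fin n, (fun k => c * ((Pi.single i 1 : Fin n → ℝ) k : ℂ)) =
      c.re • reVec i + c.im • imVec i := by
    intro i
    ext k
    rw [reVec, imVec, Pi.add_apply, Pi.smul_apply, Pi.smul_apply, Pi.single_apply, Pi.single_apply,
      Pi.single_apply]
    split_ifs <;> simp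
  rw [e, e, circleGLEquiv_entry_im, if_pos rfl] at h
  exact h

/-- Every curvature tensor of an integrable structure comes from a pair of symmetric tensors: the
integrability condition makes `(v, w) ↦ Ω(v, i w)` symmetric on `ℝⁿ`, and the first Bianchi identity
then makes `Φ(u, i v) w` totally symmetric in `u, v, w ∈ ℝⁿ` and determines the rest of `Φ`. -/
theorem exists_curvForm_eq {κ : (Fin n → ℂ) [⋀^Fin 2]→ₗ[ℝ] circleGL n}
    (hκ : κ ∈ integrableCurvature n) : ∃ p, curvForm n p = κ := by
  have hre : ∀ i j, component κ none (reVec i) (reVec j) = 0 := fun i j => by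
    simpa using component_none_eq_zero hκ 1 (by simp) i j
  have him : ∀ i j, component κ none (imVec i) (imVec j) = 0 := fun i j => by
    simpa using component_none_eq_zero hκ Complex.I (by simp) i j
  have hsymm : ∀ i j,
      component κ none (reVec i) (imVec j) = component κ none (reVec j) (imVec i) := by
    intro i j
    -- any unit complex number other than a power of `i` will do
    have h := component_none_eq_zero hκ (⟨3 / 5, 4 / 5⟩ : ℂ) (by
      rw [Complex.norm_def, Complex.normSq_mk]; norm_num) i j
    have hb : ∀ x y, component κ none x y = circleGLEquiv n (AlternatingMap.toBilin κ x y) none :=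
      fun _ _ => rfl
    rw [component_swap κ none (reVec j)]
    have h1 := hre i j
    have h2 := him i j
    rw [hb] at h h1 h2 ⊢
    rw [hb]
    simp only [map_add, map_smul, LinearMap.add_apply, LinearMap.smul_apply, Pi.add_apply,
      Pi.smul_apply, smul_eq_mul] at h
    linarith
  have hS₁ : ∀ m i j l, component κ (some (m, i)) (reVec j) (imVec l) =
      component κ (some (m, j)) (reVec i) (imVec l) := by
    intro m i j l
    have h := bianchi_re hκ.1 (reVec i) (reVec j) (imVec l) m
    simp [hre, Pi.single_apply] at h
    rw [component_swap κ _ (imVec l)] at h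
    linarith
  have hS₂ : ∀ m i j l, component κ (some (m, i)) (reVec l) (imVec j) =
      component κ (some (m, j)) (reVec l) (imVec i) := by
    intro m i j l
    have h := bianchi_im hκ.1 (imVec i) (imVec j) (reVec l) m
    simp [him, Pi.single_apply] at h
    rw [component_swap κ _ (imVec j)] at h
    linarith
  have hR : ∀ m i j l, component κ (some (m, l)) (reVec i) (reVec j) =
      component κ none (reVec i) (imVec l) * (Pi.single j 1 : Fin n → ℝ) m
        - component κ none (reVec j) (imVec l) * (Pi.single i 1 : Fin n → ℝ) m := by
    intro m i j l
    have h := bianchi_im hκ.1 (reVec i) (reVec j) (imVec l) m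
    rw [component_swap κ none (imVec l)] at h
    simp [Pi.single_apply] at h
    simp [Pi.single_apply]
    split_ifs at h ⊢ <;> linarith
  have hI : ∀ m i j l, component κ (some (m, l)) (imVec i) (imVec j) =
      component κ none (reVec i) (imVec l) * (Pi.single j 1 : Fin n → ℝ) m
        - component κ none (reVec j) (imVec l) * (Pi.single i 1 : Fin n → ℝ) m := by
    intro m i j l
    have h := bianchi_re hκ.1 (imVec i) (imVec j) (reVec l) m
    rw [component_swap κ none (imVec j), hsymm l i, hsymm l j] at h
    simp [Pi.single_apply] at h
    simp [Pi.single_apply]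
    split_ifs at h ⊢ <;> linarith
  obtain ⟨b, hb⟩ := Sym.exists_two (fun i j => component κ none (reVec i) (imVec j)) hsymm
  have hs : ∀ m, ∃ s : Sym (Fin n) 3 → ℝ, ∀ i j l, s (i ::ₛ j ::ₛ l ::ₛ Sym.nil) =
      component κ (some (m, l)) (reVec i) (imVec j) := fun m =>
    Sym.exists_three (fun i j l => component κ (some (m, l)) (reVec i) (imVec j))
      (fun i j l => by
        rw [hS₁ m l i j, hS₂ m i j l, hS₁ m j l i])
      (fun i j l => hS₂ m l j i)
  choose s hs using hs
  refine ⟨(b, s), ext_component ?_ ?_ ?_⟩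
  · rintro (_ | ⟨m, l⟩) i j
    · rw [component_curvForm, curvComp_reVec_reVec_none, hre]
    · rw [component_curvForm, curvComp_reVec_reVec_some]
      simp only [hR, hb]
  · rintro (_ | ⟨m, l⟩) i j
    · rw [component_curvForm, curvComp_reVec_imVec_none]
      simp only [hb]
    · rw [component_curvForm, curvComp_reVec_imVec_some]
      simp only [hs]
  · rintro (_ | ⟨m, l⟩) i j
    · rw [component_curvForm, curvComp_imVec_imVec_none, him]
    · rw [component_curvForm, curvComp_imVec_imVec_some]
      simp only [hI, hb]

/-- The isomorphism `S²(V*) ⊕ V ⊗ S³(V*) ≃ 𝒦_∘(𝔤)`. -/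
noncomputable def curvEquiv (n : ℕ) [NeZero n] : SymPair n ≃ₗ[ℝ] integrableCurvature n :=
  LinearEquiv.ofBijective ((curvForm n).codRestrict _ curvForm_mem)
    ⟨fun p q h => curvForm_injective (congrArg Subtype.val h), fun κ => by
      obtain ⟨p, hp⟩ := exists_curvForm_eq κ.2
      exact ⟨p, Subtype.ext hp⟩⟩

theorem curvEquiv_coe (p : SymPair n) :
    (curvEquiv n p : (Fin n → ℂ) [⋀^Fin 2]→ₗ[ℝ] circleGL n) = curvForm n p := rfl

end Curvature

/-! ### The prolongation -/

section Prolongation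

variable {n : ℕ}

theorem bil_add (b c : Sym (Fin n) 2 → ℝ) (x y : Fin n → ℝ) :
    bil (b + c) x y = bil b x y + bil c x y := by simp [bil]

theorem tril_add (b c : Sym (Fin n) 3 → ℝ) (x y z : Fin n → ℝ) :
    tril (b + c) x y z = tril b x y z + tril c x y z := by simp [tril]

theorem tril_sub (b c : Sym (Fin n) 3 → ℝ) (x y z : Fin n → ℝ) :
    tril (b - c) x y z = tril b x y z - tril c x y z := by simp [tril]

theorem tril_smul (a : ℝ) (b : Sym (Fin n) 3 → ℝ) (x y z : Fin n → ℝ) :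
    tril (a • b) x y z = a * tril b x y z := by simp [tril]

theorem bil_contract_comm (h : Sym (Fin n) 3 → ℝ) (x y z : Fin n → ℝ) :
    bil (contract x h) y z = bil (contract z h) y x := by
  rw [bil, contract_comm z x, ← bil]

theorem tril_contract_comm (h : Sym (Fin n) 4 → ℝ) (x y z w : Fin n → ℝ) :
    tril (contract x h) y z w = tril (contract w h) y z x := by
  rw [tril, contract_comm w x, ← tril]

theorem tril_cyclic (s : Sym (Fin n) 3 → ℝ) (u v w : Fin n → ℝ) :
    tril s u v w = tril s v w u := by
  rw [tril_swap_left, tril_swap_right]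

/-- The space `ℝ² ⊗ (S³(V*) ⊕ V ⊗ S⁴(V*))`, in components. -/
abbrev SymPairTwo (n : ℕ) : Type :=
  ((Sym (Fin n) 3 → ℝ) × (Sym (Fin n) 3 → ℝ)) ×
    ((Fin n → Sym (Fin n) 4 → ℝ) × (Fin n → Sym (Fin n) 4 → ℝ))

/-- The covariant derivative of the curvature defined by symmetric tensors `H₀, H₁ ∈ S³(V*)` and
`T₀, T₁ ∈ V ⊗ S⁴(V*)`: in the direction `x = x' + i x''`, the bilinear form changes by
`H₀(x', ·, ·) + H₁(x'', ·, ·)`, and the trilinear form by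
`T₀(x', ·, ·, ·) + T₁(x'', ·, ·, ·) + H₁ x' - H₀ x''`. -/
noncomputable def derivPair (n : ℕ) : SymPairTwo n →ₗ[ℝ] (Fin n → ℂ) →ₗ[ℝ] SymPair n :=
  LinearMap.mk₂ ℝ
    (fun q x => (contract (reL n x) q.1.1 + contract (imL n x) q.1.2,
      fun m => contract (reL n x) (q.2.1 m) + contract (imL n x) (q.2.2 m)
        + reL n x m • q.1.2 - imL n x m • q.1.1))
    (by
      intro p q x
      ext : 1
      · simp only [Prod.fst_add, Prod.snd_add, map_add]; abel
      · ext1 m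
        simp only [Prod.fst_add, Prod.snd_add, map_add, Pi.add_apply, smul_add]; abel)
    (by
      intro c q x
      ext : 1
      · simp only [Prod.smul_fst, Prod.smul_snd, map_smul, smul_add]
      · ext1 m
        simp only [Prod.smul_fst, Prod.smul_snd, map_smul, smul_add, smul_sub, Pi.smul_apply,
          smul_comm c])
    (by
      intro q x y
      ext : 1
      · simp only [Prod.fst_add, map_add, LinearMap.add_apply]; abel
      · ext1 m
        simp only [Prod.snd_add, map_add, LinearMap.add_apply, Pi.add_apply, add_smul]; abel)
    (by
      intro c q x
      ext : 1
      · simp only [Prod.smul_fst, map_smul, LinearMap.smul_apply, smul_add]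
      · ext1 m
        simp only [Prod.smul_snd, map_smul, LinearMap.smul_apply, smul_add, smul_sub, Pi.smul_apply,
          smul_eq_mul, mul_smul])

theorem derivPair_fst (q : SymPairTwo n) (x : Fin n → ℂ) :
    (derivPair n q x).1 = contract (reL n x) q.1.1 + contract (imL n x) q.1.2 := rfl

theorem derivPair_snd (q : SymPairTwo n) (x : Fin n → ℂ) (m : Fin n) :
    (derivPair n q x).2 m = contract (reL n x) (q.2.1 m) + contract (imL n x) (q.2.2 m)
        + reL n x m • q.1.2 - imL n x m • q.1.1 := rfl

/-- The second Bianchi identity. -/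
theorem curvComp_derivPair (q : SymPairTwo n) (x y z : Fin n → ℂ) (o : Option (Fin n × Fin n)) :
    curvComp (derivPair n q x) y z o + curvComp (derivPair n q y) z x o
      + curvComp (derivPair n q z) x y o = 0 := by
  obtain _ | ⟨m, l⟩ := o
  · have hB : ∀ x v w, bil (derivPair n q x).1 v w =
        tril q.1.1 v w (reL n x) + tril q.1.2 v w (imL n x) := fun x v w => by
      rw [derivPair_fst, bil_add]; rfl
    simp only [curvComp_none, hB]
    generalize q.1.1 = h
    generalize q.1.2 = k
    rw [tril_cyclic h (reL n y), tril_cyclic h (imL n y), tril_cyclic h (reL n z) (reL n x),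
      tril_cyclic h (reL n z) (imL n x), tril_cyclic k (reL n y) (imL n z),
      tril_cyclic k (imL n z) (imL n x), tril_cyclic k (imL n y) (reL n z),
      tril_cyclic k (imL n z) (reL n x)]
    ring
  · have hB : ∀ x v, bil (derivPair n q x).1 v (Pi.single l 1) =
        bil (contract (Pi.single l 1) q.1.1) v (reL n x)
          + bil (contract (Pi.single l 1) q.1.2) v (imL n x) := fun x v => by
      rw [derivPair_fst, bil_add, bil_contract_comm, bil_contract_comm (x := imL n x)]
    have hS : ∀ x v w, tril ((derivPair n q x).2 m) v w (Pi.single l 1) =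
        tril (contract (Pi.single l 1) (q.2.1 m)) v w (reL n x)
          + tril (contract (Pi.single l 1) (q.2.2 m)) v w (imL n x)
          + reL n x m * bil (contract (Pi.single l 1) q.1.2) v w
          - imL n x m * bil (contract (Pi.single l 1) q.1.1) v w := fun x v w => by
      rw [derivPair_snd, tril_sub, tril_add, tril_add, tril_smul, tril_smul, tril_contract_comm,
        tril_contract_comm (x := imL n x)]
      rfl
    simp only [curvComp, hB, hS]
    generalize contract (Pi.single l 1) q.1.1 = b
    generalize contract (Pi.single l 1) q.1.2 = c
    generalize contract (Pi.single l 1) (q.2.1 m) = h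
    generalize contract (Pi.single l 1) (q.2.2 m) = k
    rw [tril_cyclic h (reL n y), tril_cyclic h (imL n y), tril_cyclic h (reL n z) (reL n x),
      tril_cyclic h (reL n z) (imL n x), tril_cyclic k (reL n y) (imL n z),
      tril_cyclic k (imL n z) (imL n x), tril_cyclic k (imL n y) (reL n z),
      tril_cyclic k (imL n z) (reL n x)]
    simp only [bil_comm _ (reL n y) (reL n x), bil_comm _ (imL n y) (reL n x),
      bil_comm _ (reL n y) (imL n x), bil_comm _ (imL n y) (imL n x),
      bil_comm _ (reL n z) (reL n x), bil_comm _ (imL n z) (reL n x),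
      bil_comm _ (reL n z) (imL n x), bil_comm _ (imL n z) (imL n x),
      bil_comm _ (reL n z) (reL n y), bil_comm _ (imL n z) (reL n y),
      bil_comm _ (reL n z) (imL n y), bil_comm _ (imL n z) (imL n y)]
    ring

variable [NeZero n]

theorem mem_prolongation_iff (f : (Fin n → ℂ) →ₗ[ℝ] integrableCurvature n) :
    f ∈ (integrableCurvature n).prolongation ↔ ∀ x y z o,
      curvComp ((curvEquiv n).symm (f x)) y z o + curvComp ((curvEquiv n).symm (f y)) z x o
        + curvComp ((curvEquiv n).symm (f z)) x y o = 0 := by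
  have h : ∀ x y z o, curvComp ((curvEquiv n).symm (f x)) y z o =
      circleGLEquiv n ((f x : (Fin n → ℂ) [⋀^Fin 2]→ₗ[ℝ] circleGL n) ![y, z]) o := by
    intro x y z o
    rw [← component_curvForm, ← curvEquiv_coe, LinearEquiv.apply_symm_apply]
    rfl
  simp only [h]
  refine ⟨fun hf x y z o => ?_, fun hf x y z => ?_⟩
  · have := congrFun (congrArg (circleGLEquiv n) (hf x y z)) o
    simpa only [map_add, map_zero, Pi.add_apply, Pi.zero_apply] using this
  · refine (circleGLEquiv n).injective (funext fun o => ?_)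
    simpa only [map_add, map_zero, Pi.add_apply, Pi.zero_apply] using hf x y z o

/-- The elements of the prolongation, in terms of symmetric tensors. -/
noncomputable def prolongMap (n : ℕ) [NeZero n] :
    SymPairTwo n →ₗ[ℝ] (Fin n → ℂ) →ₗ[ℝ] integrableCurvature n where
  toFun q := (curvEquiv n).toLinearMap ∘ₗ derivPair n q
  map_add' p q := by rw [map_add, LinearMap.comp_add]
  map_smul' c q := by rw [map_smul, LinearMap.comp_smul]; rfl

theorem prolongMap_apply (q : SymPairTwo n) (x : Fin n → ℂ) :
    prolongMap n q x = curvEquiv n (derivPair n q x) := rfl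

theorem prolongMap_injective : Function.Injective (prolongMap n) := by
  refine (injective_iff_map_eq_zero _).2 fun q hq => ?_
  have h : ∀ x, derivPair n q x = 0 := fun x => by
    rw [← (curvEquiv n).map_eq_zero_iff, ← prolongMap_apply, hq]; rfl
  have h₀ : q.1.1 = 0 := funext fun M => by
    obtain ⟨i, m, rfl⟩ := Sym.exists_eq_cons_of_succ M
    have := congrFun (congrArg Prod.fst (h (reVec i))) m
    simpa [derivPair_fst, contract_single] using this
  have h₁ : q.1.2 = 0 := funext fun M => by
    obtain ⟨i, m, rfl⟩ := Sym.exists_eq_cons_of_succ M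
    have := congrFun (congrArg Prod.fst (h (imVec i))) m
    simpa [derivPair_fst, contract_single] using this
  refine Prod.ext (Prod.ext h₀ h₁) (Prod.ext (funext fun k => funext fun M => ?_)
    (funext fun k => funext fun M => ?_))
  · obtain ⟨i, m, rfl⟩ := Sym.exists_eq_cons_of_succ M
    have := congrFun (congrFun (congrArg Prod.snd (h (reVec i))) k) m
    simpa [derivPair_snd, contract_single, h₀, h₁] using this
  · obtain ⟨i, m, rfl⟩ := Sym.exists_eq_cons_of_succ M
    have := congrFun (congrFun (congrArg Prod.snd (h (imVec i))) k) m
    simpa [derivPair_snd, contract_single, h₀, h₁] using this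

/-- The second Bianchi identity makes all the tensors that describe an element of the
prolongation totally symmetric, after the corrections `H₁ x'` and `H₀ x''`. -/
theorem range_prolongMap :
    LinearMap.range (prolongMap n) = (integrableCurvature n).prolongation := by
  refine le_antisymm ?_ fun f hf => ?_
  · rintro _ ⟨q, rfl⟩
    rw [mem_prolongation_iff]
    simpa only [prolongMap_apply, LinearEquiv.symm_apply_apply] using curvComp_derivPair q
  rw [mem_prolongation_iff] at hf
  set P : (Fin n → ℂ) →ₗ[ℝ] SymPair n := (curvEquiv n).symm.toLinearMap ∘ₗ f with hP
  have hf : ∀ x y z o, curvComp (P x) y z o + curvComp (P y) z x o + curvComp (P z) x y o = 0 := hf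
  obtain ⟨h₀, hh₀⟩ := Sym.exists_eq_cons (fun u => (P (reVec u)).1) (by
    intro u v m
    obtain ⟨w, m, rfl⟩ := Sym.exists_eq_cons_of_succ m
    rw [Sym.eq_nil_of_card_zero m]
    have h := hf (reVec u) (reVec v) (imVec w) none
    rw [curvComp_swap _ (imVec w), Pi.neg_apply, curvComp_reVec_imVec_none,
      curvComp_reVec_imVec_none, curvComp_reVec_reVec_none] at h
    linarith)
  obtain ⟨h₁, hh₁⟩ := Sym.exists_eq_cons (fun u => (P (imVec u)).1) (by
    intro u v m
    obtain ⟨w, m, rfl⟩ := Sym.exists_eq_cons_of_succ m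
    rw [Sym.eq_nil_of_card_zero m]
    have h := hf (imVec u) (imVec v) (reVec w) none
    rw [curvComp_swap _ (imVec v), Pi.neg_apply, curvComp_reVec_imVec_none,
      curvComp_reVec_imVec_none, curvComp_imVec_imVec_none, Sym.cons_swap w, Sym.cons_swap w] at h
    linarith)
  have hT₀ : ∀ m, ∃ T : Sym (Fin n) 4 → ℝ, ∀ u M,
      T (u ::ₛ M) = (P (reVec u)).2 m M - (Pi.single u 1 : Fin n → ℝ) m * h₁ M := by
    intro m
    refine Sym.exists_eq_cons
      (fun u M => (P (reVec u)).2 m M - (Pi.single u 1 : Fin n → ℝ) m * h₁ M) fun u v M => ?_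
    induction M using Sym.two_cases with | h w l => ?_
    have h := hf (reVec u) (reVec v) (imVec w) (some (m, l))
    rw [curvComp_swap _ (imVec w), Pi.neg_apply, curvComp_reVec_imVec_some,
      curvComp_reVec_imVec_some, curvComp_reVec_reVec_some] at h
    rw [Sym.cons_swap v w, Sym.cons_swap u w, hh₁, hh₁, Sym.cons_swap w v, Sym.cons_swap w u]
    linarith
  have hT₁ : ∀ m, ∃ T : Sym (Fin n) 4 → ℝ, ∀ u M,
      T (u ::ₛ M) = (P (imVec u)).2 m M + (Pi.single u 1 : Fin n → ℝ) m * h₀ M := by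
    intro m
    refine Sym.exists_eq_cons
      (fun u M => (P (imVec u)).2 m M + (Pi.single u 1 : Fin n → ℝ) m * h₀ M) fun u v M => ?_
    induction M using Sym.two_cases with | h w l => ?_
    have h := hf (imVec u) (imVec v) (reVec w) (some (m, l))
    rw [curvComp_swap _ (imVec v), Pi.neg_apply, curvComp_reVec_imVec_some,
      curvComp_reVec_imVec_some, curvComp_imVec_imVec_some] at h
    rw [Sym.cons_swap v w, Sym.cons_swap u w, hh₀, hh₀]
    linarith
  choose T₀ hT₀ using hT₀
  choose T₁ hT₁ using hT₁
  have key : derivPair n ((h₀, h₁), (T₀, T₁)) = P := by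
    refine LinearMap.ext_realBasis (fun u => Prod.ext ?_ (funext fun m => ?_))
      (fun u => Prod.ext ?_ (funext fun m => ?_))
    · ext M
      simp [derivPair_fst, contract_single, hh₀]
    · ext M
      simp [derivPair_snd, contract_single, hT₀]
    · ext M
      simp [derivPair_fst, contract_single, hh₁]
    · ext M
      simp [derivPair_snd, contract_single, hT₁]
  refine ⟨((h₀, h₁), (T₀, T₁)), LinearMap.ext fun x => ?_⟩
  rw [prolongMap_apply, key]
  exact (curvEquiv n).apply_symm_apply (f x)

theorem finrank_prolongation : finrank ℝ (integrableCurvature n).prolongation =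
    2 * Nat.multichoose n 3 + 2 * (n * Nat.multichoose n 4) := by
  rw [← range_prolongMap, LinearMap.finrank_range_of_inj prolongMap_injective]
  simp only [finrank_prod, finrank_pi_fintype, finrank_self, Finset.sum_const, Finset.card_univ,
    Sym.card_sym_eq_multichoose, Fintype.card_fin, smul_eq_mul, mul_one]
  ring

theorem finrank_integrableCurvature : finrank ℝ (integrableCurvature n) =
    Nat.multichoose n 2 + n * Nat.multichoose n 3 := by
  rw [← (curvEquiv n).finrank_eq]
  simp only [finrank_prod, finrank_pi_fintype, finrank_self, Finset.sum_const, Finset.card_univ,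
    Sym.card_sym_eq_multichoose, Fintype.card_fin, smul_eq_mul, mul_one]

end Prolongation

/-! ### Semicontinuity of ranks -/

section Rank

/-- The rank of a linear map that depends continuously on a parameter is lower semicontinuous. -/
theorem eventually_finrank_range_le {X : Type*} [AddCommGroup X] [Module ℝ X] {ι : Type*}
    [Fintype ι] (R : ℝ → X →ₗ[ℝ] (ι → ℝ)) (hR : ∀ x, Continuous fun t => R t x) :
    ∀ᶠ t in nhds 0, finrank ℝ (LinearMap.range (R 0)) ≤ finrank ℝ (LinearMap.range (R t)) := by
  set r := finrank ℝ (LinearMap.range (R 0))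
  let v := finBasis ℝ (LinearMap.range (R 0))
  have hx : ∀ i, ∃ x, R 0 x = v i := fun i => (v i).2
  choose x hx using hx
  have h0 : LinearIndependent ℝ fun i => R 0 (x i) := by
    simp only [hx]
    exact v.linearIndependent.map' (LinearMap.range (R 0)).subtype (Submodule.ker_subtype _)
  have hc : Continuous fun t i => R t (x i) := continuous_pi fun i => hR (x i)
  filter_upwards [hc.continuousAt.preimage_mem_nhds
    (isOpen_setOfPred_linearIndependent.mem_nhds h0)] with t ht
  have ht : LinearIndependent ℝ fun i => R t (x i) := ht
  have hs : Submodule.span ℝ (Set.range fun i => R t (x i)) ≤ LinearMap.range (R t) :=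
    Submodule.span_le.2 (by rintro _ ⟨i, rfl⟩; exact ⟨_, rfl⟩)
  have := Submodule.finrank_mono hs
  rwa [finrank_span_eq_card ht, Fintype.card_fin] at this

/-- In a pencil `N₀ + t N₁` of linear maps, all members but finitely many have rank at least that
of `N₁`. -/
theorem finite_finrank_ker_lt {Y Z : Type*} [AddCommGroup Y] [Module ℝ Y] [FiniteDimensional ℝ Y]
    [AddCommGroup Z] [Module ℝ Z] (N₀ N₁ : Y →ₗ[ℝ] Z) :
    {t : ℝ | finrank ℝ (LinearMap.ker N₁) < finrank ℝ (LinearMap.ker (N₀ + t • N₁))}.Finite := by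
  obtain ⟨C, hC⟩ := (LinearMap.ker N₁).exists_isCompl
  obtain ⟨L, hL⟩ := (N₁ ∘ₗ C.subtype).exists_leftInverse_of_injective (by
    rw [LinearMap.ker_eq_bot']
    rintro ⟨x, hxC⟩ hx
    exact Subtype.ext (Submodule.disjoint_def.1 hC.disjoint x hx hxC))
  let A : End ℝ C := L ∘ₗ N₀ ∘ₗ C.subtype
  -- outside the eigenvalues of `-A`, the kernel meets `C` trivially
  refine ((Module.End.finite_hasEigenvalue A).image fun t => -t).subset fun t ht => ?_
  rw [Set.mem_ofPred_eq, ← not_le] at ht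
  by_contra hA
  refine ht ?_
  have hdisj : Disjoint (LinearMap.ker (N₀ + t • N₁)) C := by
    rw [Submodule.disjoint_def]
    intro x hx hxC
    by_contra hx0
    refine hA ⟨-t, ?_, neg_neg t⟩
    refine Module.End.hasEigenvalue_of_hasEigenvector (x := ⟨x, hxC⟩)
      ⟨Module.End.mem_eigenspace_iff.2 ?_, fun h => hx0 (congrArg Subtype.val h)⟩
    have h1 : L (N₁ x) = ⟨x, hxC⟩ := LinearMap.congr_fun hL ⟨x, hxC⟩
    have h2 := congrArg L (LinearMap.mem_ker.1 hx)
    rw [LinearMap.add_apply, LinearMap.smul_apply, map_add, map_smul, h1, map_zero] at h2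
    rw [neg_smul]
    exact eq_neg_of_add_eq_zero_left h2
  have h1 := Submodule.finrank_add_finrank_le_of_disjoint hdisj
  have h2 := Submodule.finrank_add_eq_of_isCompl hC
  omega

theorem finrank_ker_le_of {Y Z Z' : Type*} [AddCommGroup Y] [Module ℝ Y] [AddCommGroup Z]
    [Module ℝ Z] [AddCommGroup Z'] [Module ℝ Z'] [FiniteDimensional ℝ Z'] (N : Y →ₗ[ℝ] Z)
    (f : Y →ₗ[ℝ] Z') (h : ∀ y, N y = 0 → f y = 0 → y = 0) :
    finrank ℝ (LinearMap.ker N) ≤ finrank ℝ Z' :=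
  LinearMap.finrank_le_finrank_of_injective (f := f.domRestrict (LinearMap.ker N))
    ((injective_iff_map_eq_zero _).2 fun y hy => Subtype.ext (h y y.2 hy))

theorem finrank_le_finrank_ker {Y Z : Type*} [AddCommGroup Y] [Module ℝ Y]
    [FiniteDimensional ℝ Y] [AddCommGroup Z] [Module ℝ Z] {N : Y →ₗ[ℝ] Z} {S : Submodule ℝ Y}
    (h : S ≤ LinearMap.ker N) : finrank ℝ S ≤ finrank ℝ (LinearMap.ker N) :=
  Submodule.finrank_mono h

theorem finrank_le_of_map_eq_top {Y Z : Type*} [AddCommGroup Y] [Module ℝ Y]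
    [FiniteDimensional ℝ Y] [AddCommGroup Z] [Module ℝ Z] {f : Y →ₗ[ℝ] Z} {S : Submodule ℝ Y}
    (h : S.map f = ⊤) : finrank ℝ Z ≤ finrank ℝ S := by
  rw [← finrank_top ℝ Z, ← h]
  exact Submodule.finrank_map_le f S

theorem Submodule.exists_le_finrank_eq {E : Type*} [AddCommGroup E] [Module ℝ E]
    [FiniteDimensional ℝ E] (F : Submodule ℝ E) {k : ℕ} (h₁ : finrank ℝ F ≤ k)
    (h₂ : k ≤ finrank ℝ E) : ∃ F' : Submodule ℝ E, F ≤ F' ∧ finrank ℝ F' = k := by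
  induction k, h₁ using Nat.le_induction with
  | base => exact ⟨F, le_rfl, rfl⟩
  | succ k _ ih =>
    obtain ⟨F', hF, hk⟩ := ih (by omega)
    obtain ⟨x, hx⟩ : ∃ x, x ∉ F' := by
      by_contra! h
      rw [(Submodule.eq_top_iff'.2 h), finrank_top] at hk
      omega
    refine ⟨F' ⊔ Submodule.span ℝ {x}, hF.trans le_sup_left, ?_⟩
    rw [Submodule.finrank_sup_span_singleton hx, hk]

end Rank

/-! ### Restriction of curvature tensors to subspaces -/

section Restriction

variable {E E' E'' W : Type*} [AddCommGroup E] [Module ℝ E] [AddCommGroup E'] [Module ℝ E']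
  [AddCommGroup E''] [Module ℝ E''] [AddCommGroup W] [Module ℝ W]

/-- Pullback of forms of degree two along a linear map. -/
def formPullback (e : E' →ₗ[ℝ] E) : (E [⋀^Fin 2]→ₗ[ℝ] W) →ₗ[ℝ] (E' [⋀^Fin 2]→ₗ[ℝ] W) where
  toFun κ := κ.compLinearMap e
  map_add' _ _ := rfl
  map_smul' _ _ := rfl

theorem formPullback_apply (e : E' →ₗ[ℝ] E) (κ : E [⋀^Fin 2]→ₗ[ℝ] W) (x y : E') :
    formPullback e κ ![x, y] = κ ![e x, e y] := by
  change κ (fun i => e (![x, y] i)) = _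
  exact congrArg κ (by ext i; fin_cases i <;> rfl)

theorem formPullback_comp (e : E' →ₗ[ℝ] E) (f : E'' →ₗ[ℝ] E') :
    (formPullback (W := W) (e ∘ₗ f)) = formPullback f ∘ₗ formPullback e := rfl

theorem restrict_eq_formPullback (F : Submodule ℝ E) :
    SecondLevelTableau.restrict (W := W) F = formPullback F.subtype := rfl

variable [FiniteDimensional ℝ E] [FiniteDimensional ℝ W]

theorem finrank_map_formPullback_comp_le (K : SecondLevelTableau E W) (e : E' →ₗ[ℝ] E)
    (f : E'' →ₗ[ℝ] E') :
    finrank ℝ (K.map (formPullback (e ∘ₗ f))) ≤ finrank ℝ (K.map (formPullback e)) := by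
  rw [formPullback_comp, Submodule.map_comp]
  exact Submodule.finrank_map_le _ _

theorem finrank_map_restrict_mono (K : SecondLevelTableau E W) {F F' : Submodule ℝ E} (h : F ≤ F') :
    finrank ℝ (K.map (SecondLevelTableau.restrict F)) ≤
      finrank ℝ (K.map (SecondLevelTableau.restrict F')) :=
  finrank_map_formPullback_comp_le K F'.subtype (Submodule.inclusion h)

/-- A bound, valid for all pullbacks to a space of dimension `k` and attained, gives the generic
rank. -/
theorem genericRank_eq {K : SecondLevelTableau E W} {k r : ℕ} (hk : k ≤ finrank ℝ E)
    (h₁ : ∀ e : (Fin k → ℝ) →ₗ[ℝ] E, finrank ℝ (K.map (formPullback e)) ≤ r)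
    (h₂ : ∃ F : Submodule ℝ E, finrank ℝ F ≤ k ∧
      r ≤ finrank ℝ (K.map (SecondLevelTableau.restrict F))) :
    K.genericRank k = r := by
  have hub : ∀ F : Submodule ℝ E, finrank ℝ F = k →
      finrank ℝ (K.map (SecondLevelTableau.restrict F)) ≤ r := by
    intro F hF
    let φ : F ≃ₗ[ℝ] (Fin k → ℝ) := LinearEquiv.ofFinrankEq _ _ (by simp [hF])
    have h : F.subtype = (F.subtype ∘ₗ φ.symm.toLinearMap) ∘ₗ φ.toLinearMap := by
      ext x; simp
    rw [restrict_eq_formPullback, h]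
    exact (finrank_map_formPullback_comp_le K _ _).trans (h₁ _)
  obtain ⟨F, hFk, hF⟩ := h₂
  obtain ⟨F', hFF', hF'⟩ := F.exists_le_finrank_eq hFk hk
  rw [SecondLevelTableau.genericRank]
  refine IsGreatest.csSup_eq ⟨⟨F', hF', le_antisymm ?_ (hub F' hF')⟩, ?_⟩
  · exact hF.trans (finrank_map_restrict_mono K hFF')
  · rintro _ ⟨F, hF, rfl⟩
    exact hub F hF

end Restriction

/-! ### The generic flag and the Cartan characters -/

section Frame

variable {n k : ℕ}

/-- The linear map `ℝᵏ → ℂⁿ` (for `k ≤ n`) taking the `j`-th basis vector to `(1 + i j) e_j`. Any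
coefficients that are pairwise independent over `ℝ` would do as well. -/
noncomputable def diagFrame (hk : k ≤ n) : (Fin k → ℝ) →ₗ[ℝ] (Fin n → ℂ) :=
  Fintype.linearCombination ℝ
    fun j : Fin k => reVec (Fin.castLE hk j) + (j : ℝ) • imVec (Fin.castLE hk j)

theorem diagFrame_single (hk : k ≤ n) (j : Fin k) :
    diagFrame hk (Pi.single j 1) = reVec (Fin.castLE hk j) + (j : ℝ) • imVec (Fin.castLE hk j) := by
  rw [diagFrame, Fintype.linearCombination_apply_single, one_smul]

theorem reL_diag (i : Fin n) (a : ℝ) : reL n (reVec i + a • imVec i) = Pi.single i 1 := by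
  simp

theorem imL_diag (i : Fin n) (a : ℝ) : imL n (reVec i + a • imVec i) = a • Pi.single i 1 := by
  simp

theorem curvComp_diag_none (p : SymPair n) (i j : Fin n) (a c : ℝ) :
    curvComp p (reVec i + a • imVec i) (reVec j + c • imVec j) none =
      (c - a) * p.1 (i ::ₛ j ::ₛ Sym.nil) := by
  rw [← bil_single p.1, curvComp, reL_diag, reL_diag, imL_diag, imL_diag]
  simp [bil]
  ring

theorem curvComp_diag_some (p : SymPair n) (i j m l : Fin n) (a c : ℝ) :
    curvComp p (reVec i + a • imVec i) (reVec j + c • imVec j) (some (m, l)) =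
      (c - a) * p.2 m (i ::ₛ j ::ₛ l ::ₛ Sym.nil)
        + (1 + a * c) * (p.1 (i ::ₛ l ::ₛ Sym.nil) * (Pi.single j 1 : Fin n → ℝ) m
          - p.1 (j ::ₛ l ::ₛ Sym.nil) * (Pi.single i 1 : Fin n → ℝ) m) := by
  rw [← bil_single p.1, ← bil_single p.1, ← tril_single (p.2 m), curvComp, reL_diag, reL_diag,
    imL_diag, imL_diag]
  simp [bil, tril]
  ring

/-- The pairs `i < j < k`. -/
abbrev PairIndex (k : ℕ) : Type := {p : Fin k × Fin k // p.1 < p.2}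

/-- The triples `(i, j, l)` with `i < j < k` and `l = i` or `j ≤ l < n`. They correspond to the
unordered triples with at least two different members below `k`. -/
abbrev TripleIndex (hk : k ≤ n) : Type :=
  {q : (Fin k × Fin k) × Fin n //
    q.1.1 < q.1.2 ∧ (q.2 = Fin.castLE hk q.1.1 ∨ Fin.castLE hk q.1.2 ≤ q.2)}

theorem card_pairIndex (k : ℕ) : Fintype.card (PairIndex k) = ∑ j ∈ Finset.range k, j := by
  rw [Fintype.card_subtype, Finset.card_filter, Fintype.sum_prod_type_right,
    ← Fin.sum_univ_eq_sum_range]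
  refine Finset.sum_congr rfl fun j _ => ?_
  rw [← Finset.card_filter, ← Fin.card_Iio]
  congr 1
  ext i
  simp

theorem card_tripleIndex (hk : k ≤ n) :
    Fintype.card (TripleIndex hk) = ∑ j ∈ Finset.range k, j * (n + 1 - j) := by
  rw [Fintype.card_subtype, Finset.card_filter, Fintype.sum_prod_type, Fintype.sum_prod_type_right,
    ← Fin.sum_univ_eq_sum_range fun j => j * (n + 1 - j)]
  refine Finset.sum_congr rfl fun j _ => ?_
  have h : ∀ i : Fin k, (∑ l : Fin n, if i < j ∧ (l = Fin.castLE hk i ∨ Fin.castLE hk j ≤ l)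
      then 1 else 0) = if i < j then n + 1 - j else 0 := by
    intro i
    split_ifs with hij
    · rw [← Finset.card_filter]
      have : (Finset.univ.filter fun l : Fin n =>
          i < j ∧ (l = Fin.castLE hk i ∨ Fin.castLE hk j ≤ l)) =
          insert (Fin.castLE hk i) (Finset.Ici (Fin.castLE hk j)) := by
        ext l; simp [hij]
      rw [this, Finset.card_insert_of_notMem (by simpa using hij), Fin.card_Ici, Fin.val_castLE]
      have := j.2
      omega
    · simp [hij]
  simp only [h]
  rw [← Finset.sum_filter, Finset.sum_const, smul_eq_mul]
  congr 1
  rw [← Fin.card_Iio]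
  congr 1
  ext i
  simp

variable [NeZero n]

/-- The `𝔤`-valued forms of degree two on a vector space. -/
abbrev CircleGLForm (n : ℕ) (E : Type*) [AddCommGroup E] [Module ℝ E] : Type _ :=
  E [⋀^Fin 2]→ₗ[ℝ] circleGL n

/-- The components of a `𝔤`-valued form on `ℝᵏ` that are independent for forms on the span of the
diagonal frame satisfying the first Bianchi identity. -/
noncomputable def frameCoord (hk : k ≤ n) : CircleGLForm n (Fin k → ℝ) →ₗ[ℝ]
    (PairIndex k → ℝ) × (Fin n → TripleIndex hk → ℝ) where
  toFun κ := (fun p => component κ none (Pi.single p.1.1 1) (Pi.single p.1.2 1),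
    fun m q => component κ (some (m, q.1.2)) (Pi.single q.1.1.1 1) (Pi.single q.1.1.2 1))
  map_add' κ μ := by
    ext <;> simp [component]
  map_smul' c κ := by
    ext <;> simp [component]

/-- The first Bianchi map, for forms on `ℝᵏ` and a linear map `e : ℝᵏ → ℂⁿ`. -/
noncomputable def frameBianchi (e : (Fin k → ℝ) →ₗ[ℝ] (Fin n → ℂ)) :
    CircleGLForm n (Fin k → ℝ) →ₗ[ℝ] (Fin k → Fin k → Fin k → Fin n → ℂ) where
  toFun κ i j l :=
    (κ ![Pi.single i 1, Pi.single j 1] : Matrix (Fin n) (Fin n) ℂ).mulVec (e (Pi.single l 1))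
    + (κ ![Pi.single j 1, Pi.single l 1] : Matrix (Fin n) (Fin n) ℂ).mulVec (e (Pi.single i 1))
    + (κ ![Pi.single l 1, Pi.single i 1] : Matrix (Fin n) (Fin n) ℂ).mulVec (e (Pi.single j 1))
  map_add' κ μ := by
    funext i j l
    simp only [AlternatingMap.add_apply, Submodule.coe_add, Matrix.add_mulVec, Pi.add_apply]
    abel
  map_smul' c κ := by
    funext i j l
    simp only [AlternatingMap.smul_apply, Submodule.coe_smul, Matrix.smul_mulVec, Pi.smul_apply,
      smul_add, RingHom.id_apply]

omit [NeZero n] in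
theorem frameBianchi_add_smul (e f : (Fin k → ℝ) →ₗ[ℝ] (Fin n → ℂ)) (t : ℝ) :
    frameBianchi (e + t • f) = frameBianchi e + t • frameBianchi f := by
  refine LinearMap.ext fun κ => ?_
  funext i j l
  simp only [frameBianchi, LinearMap.coe_mk, AddHom.coe_mk, LinearMap.add_apply,
    LinearMap.smul_apply, Pi.add_apply, Pi.smul_apply, Matrix.mulVec_add, Matrix.mulVec_smul,
    smul_add]
  abel

omit [NeZero n] in
theorem formPullback_mem_ker (e : (Fin k → ℝ) →ₗ[ℝ] (Fin n → ℂ))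
    {κ : (Fin n → ℂ) [⋀^Fin 2]→ₗ[ℝ] circleGL n} (hκ : κ ∈ integrableCurvature n) :
    formPullback e κ ∈ LinearMap.ker (frameBianchi e) := by
  rw [LinearMap.mem_ker]
  funext i j l
  simp only [frameBianchi, LinearMap.coe_mk, AddHom.coe_mk, formPullback_apply]
  exact hκ.1 _ _ _

theorem component_ext_zero {κ : CircleGLForm n (Fin k → ℝ)}
    (h : ∀ o, ∀ i j : Fin k, i < j → component κ o (Pi.single i 1) (Pi.single j 1) = 0) :
    κ = 0 := by
  refine Basis.ext_alternating (Pi.basisFun ℝ (Fin k)) fun v hv => ?_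
  have hv' : (fun i => Pi.basisFun ℝ (Fin k) (v i)) =
      ![Pi.single (v 0) 1, Pi.single (v 1) 1] := by
    ext i : 1; fin_cases i <;> simp
  rw [hv', AlternatingMap.zero_apply]
  refine (circleGLEquiv n).injective (funext fun o => ?_)
  rw [map_zero, Pi.zero_apply]
  change component κ o _ _ = 0
  rcases lt_trichotomy (v 0) (v 1) with h1 | h1 | h1
  · exact h _ _ _ h1
  · exact absurd (hv h1) (by decide)
  · rw [component_swap, h _ _ _ h1, neg_zero]

/-- Along the diagonal frame `f_j = (1 + i j) e_j`, the first Bianchi identity for `i < j`, `l < j`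
and `l ≠ i` expresses the column `l` of `Φ(f_i, f_j)` by the column `j` of `Φ(f_l, f_i)` and by
`Ω`. -/
theorem finrank_ker_frameBianchi_diagFrame_le (hk : k ≤ n) :
    finrank ℝ (LinearMap.ker (frameBianchi (diagFrame hk))) ≤
      Fintype.card (PairIndex k) + n * Fintype.card (TripleIndex hk) := by
  have hd : finrank ℝ ((PairIndex k → ℝ) × (Fin n → TripleIndex hk → ℝ)) =
      Fintype.card (PairIndex k) + n * Fintype.card (TripleIndex hk) := by
    simp only [finrank_prod, finrank_pi_fintype, finrank_self, Finset.sum_const, Finset.card_univ,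
      Fintype.card_fin, smul_eq_mul, mul_one]
  rw [← hd]
  refine finrank_ker_le_of (Y := CircleGLForm n (Fin k → ℝ)) _ (frameCoord hk) fun κ hκ h => ?_
  have hP : ∀ i j : Fin k, i < j → component κ none (Pi.single i 1) (Pi.single j 1) = 0 :=
    fun i j hij => congrFun (congrArg Prod.fst h) ⟨(i, j), hij⟩
  have hQ : ∀ (m : Fin n) (i j : Fin k) (l : Fin n), i < j →
      (l = Fin.castLE hk i ∨ Fin.castLE hk j ≤ l) →
      component κ (some (m, l)) (Pi.single i 1) (Pi.single j 1) = 0 :=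
    fun m i j l hij hl => congrFun (congrFun (congrArg Prod.snd h) m) ⟨((i, j), l), hij, hl⟩
  have hP' : ∀ i j : Fin k, component κ none (Pi.single i 1) (Pi.single j 1) = 0 := by
    intro i j
    rcases lt_trichotomy i j with h1 | rfl | h1
    · exact hP i j h1
    · rw [component, AlternatingMap.pair_self, map_zero]; rfl
    · rw [component_swap, hP j i h1, neg_zero]
  refine component_ext_zero fun o i j hij => ?_
  obtain _ | ⟨m, l⟩ := o
  · exact hP i j hij
  by_cases hl : l = Fin.castLE hk i ∨ Fin.castLE hk j ≤ l
  · exact hQ m i j l hij hl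
  push Not at hl
  obtain ⟨l, rfl⟩ : ∃ l' : Fin k, l = Fin.castLE hk l' :=
    ⟨⟨l, (Fin.lt_def.1 hl.2).trans j.2⟩, rfl⟩
  have hlj : l < j := hl.2
  have hli : l ≠ i := fun h => hl.1 (h ▸ rfl)
  have h3 : component κ (some (m, Fin.castLE hk j)) (Pi.single l 1) (Pi.single i 1) = 0 := by
    rcases lt_or_gt_of_ne hli with h1 | h1
    · exact hQ m l i _ h1 (Or.inr (by simpa using hij.le))
    · rw [component_swap, hQ m i l _ h1 (Or.inr (by simpa using hlj.le)), neg_zero]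
  have hB := congrFun (congrFun (congrFun (congrFun hκ i) j) l) m
  simp only [frameBianchi, LinearMap.coe_mk, AddHom.coe_mk, diagFrame_single] at hB
  have hre := congrArg Complex.re hB
  have him := congrArg Complex.im hB
  simp only [Pi.add_apply, Complex.add_re, circleGL_mulVec_re, reL_diag, imL_diag] at hre
  simp only [Pi.add_apply, Complex.add_im, circleGL_mulVec_im, reL_diag, imL_diag] at him
  simp only [component] at hP' h3 ⊢
  simp [hP', Pi.single_apply, h3] at hre him
  have hne : ((l : ℕ) : ℝ) - (i : ℕ) ≠ 0 := by
    rw [sub_ne_zero]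
    exact_mod_cast fun h => hli (Fin.ext h)
  refine (mul_eq_zero.1 (?_ : (((l : ℕ) : ℝ) - (i : ℕ)) * _ = 0)).resolve_left hne
  -- `1 + i I` and `1 + l I` are the coefficients of the frame; this combination removes the
  -- component with the coefficient of `e_i`
  linear_combination him - (i : ℕ) * hre

omit [NeZero n] in
theorem sym_pair_injective {i j i' j' : Fin n} (h : i < j) (h' : i' < j')
    (he : i ::ₛ j ::ₛ (Sym.nil : Sym (Fin n) 0) = i' ::ₛ j' ::ₛ Sym.nil) : i = i' ∧ j = j' := by
  have he' := congrArg (fun s : Sym (Fin n) 2 => (s : Multiset (Fin n))) he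
  simp only [Sym.coe_cons, Sym.coe_nil] at he'
  rcases Multiset.cons_eq_cons.1 he' with ⟨rfl, h1⟩ | ⟨-, c, h1, h2⟩
  · exact ⟨rfl, by simpa using h1⟩
  · have h3 : i' ∈ ({j} : Multiset (Fin n)) := by
      change i' ∈ j ::ₘ 0; rw [h1]; simp
    have h4 : i ∈ ({j'} : Multiset (Fin n)) := by
      change i ∈ j' ::ₘ 0; rw [h2]; simp
    rw [Multiset.mem_singleton] at h3 h4
    omega

omit [NeZero n] in
/-- An unordered triple is of the form `{i, i, j}` or `{i, j, l}` with `i < j ≤ l` in at most one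
way. -/
theorem sym_triple_injective {i j l i' j' l' : Fin n} (h : i < j) (h' : i' < j')
    (hl : l = i ∨ j ≤ l) (hl' : l' = i' ∨ j' ≤ l')
    (he : i ::ₛ j ::ₛ l ::ₛ (Sym.nil : Sym (Fin n) 0) = i' ::ₛ j' ::ₛ l' ::ₛ Sym.nil) :
    i = i' ∧ j = j' ∧ l = l' := by
  have he' := congrArg (fun s : Sym (Fin n) 3 => (s : Multiset (Fin n))) he
  simp only [Sym.coe_cons, Sym.coe_nil] at he'
  have hi : i ∈ i' ::ₘ j' ::ₘ l' ::ₘ (0 : Multiset (Fin n)) := by rw [← he']; simp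
  have hi' : i' ∈ i ::ₘ j ::ₘ l ::ₘ (0 : Multiset (Fin n)) := by rw [he']; simp
  simp only [Multiset.mem_cons, Multiset.notMem_zero, or_false] at hi hi'
  obtain rfl : i = i' := by omega
  rw [Multiset.cons_inj_right] at he'
  have hj : j ∈ j' ::ₘ l' ::ₘ (0 : Multiset (Fin n)) := by rw [← he']; simp
  have hj' : j' ∈ j ::ₘ l ::ₘ (0 : Multiset (Fin n)) := by rw [he']; simp
  simp only [Multiset.mem_cons, Multiset.notMem_zero, or_false] at hj hj'
  obtain rfl : j = j' := by omega
  rw [Multiset.cons_inj_right] at he'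
  exact ⟨rfl, rfl, by simpa using he'⟩

/-- On the span of the diagonal frame, the independent components can be prescribed. -/
theorem frameCoord_comp_surjective (hk : k ≤ n) : Function.Surjective
    (frameCoord hk ∘ₗ formPullback (diagFrame hk) ∘ₗ curvForm n) := by
  rintro ⟨u, v⟩
  have h2 : Function.Injective fun p : PairIndex k =>
      Fin.castLE hk p.1.1 ::ₛ Fin.castLE hk p.1.2 ::ₛ (Sym.nil : Sym (Fin n) 0) := by
    rintro ⟨⟨i, j⟩, h⟩ ⟨⟨i', j'⟩, h'⟩ he
    have := sym_pair_injective (by simpa using h) (by simpa using h') he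
    simp only [Fin.castLE_inj] at this
    simp [this]
  have h3 : Function.Injective fun q : TripleIndex hk =>
      Fin.castLE hk q.1.1.1 ::ₛ Fin.castLE hk q.1.1.2 ::ₛ q.1.2 ::ₛ (Sym.nil : Sym (Fin n) 0) := by
    rintro ⟨⟨⟨i, j⟩, l⟩, h, hl⟩ ⟨⟨⟨i', j'⟩, l'⟩, h', hl'⟩ he
    have := sym_triple_injective (by simpa using h) (by simpa using h') hl hl' he
    simp only [Fin.castLE_inj] at this
    simp [this]
  -- the prescribed components are those of `B` and `S`, up to nonzero factors and a correction of
  -- `S` by terms in `B`; since they belong to different unordered tuples, `B` and `S` exist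
  obtain ⟨b, hb⟩ := h2.surjective_comp_right
    (fun p : PairIndex k => u p / ((p.1.2 : ℕ) - (p.1.1 : ℕ) : ℝ))
  have hs : ∀ m, ∃ s : Sym (Fin n) 3 → ℝ, ∀ q : TripleIndex hk,
      s (Fin.castLE hk q.1.1.1 ::ₛ Fin.castLE hk q.1.1.2 ::ₛ q.1.2 ::ₛ Sym.nil) =
      (v m q - (1 + (q.1.1.1 : ℕ) * (q.1.1.2 : ℕ)) *
        (b (Fin.castLE hk q.1.1.1 ::ₛ q.1.2 ::ₛ Sym.nil)
            * (Pi.single (Fin.castLE hk q.1.1.2) 1 : Fin n → ℝ) m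
          - b (Fin.castLE hk q.1.1.2 ::ₛ q.1.2 ::ₛ Sym.nil)
            * (Pi.single (Fin.castLE hk q.1.1.1) 1 : Fin n → ℝ) m))
        / ((q.1.1.2 : ℕ) - (q.1.1.1 : ℕ) : ℝ) := fun m => by
    obtain ⟨s, hs⟩ := h3.surjective_comp_right (γ := ℝ) _
    exact ⟨s, congrFun hs⟩
  choose s hs using hs
  have hcomp : ∀ o (x y : Fin k → ℝ), component (formPullback (diagFrame hk) (curvForm n (b, s))) o
      x y = curvComp (b, s) (diagFrame hk x) (diagFrame hk y) o := by
    intro o x y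
    rw [← component_curvForm, component, formPullback_apply, component]
  have hne : ∀ i j : Fin k, i < j → ((j : ℕ) : ℝ) - ((i : ℕ) : ℝ) ≠ 0 := by
    intro i j hij
    rw [sub_ne_zero]
    exact_mod_cast (Fin.lt_def.1 hij).ne'
  refine ⟨(b, s), Prod.ext (funext fun p => ?_) (funext fun m => funext fun q => ?_)⟩
  · change component (formPullback (diagFrame hk) (curvForm n (b, s))) none _ _ = u p
    rw [hcomp, diagFrame_single, diagFrame_single, curvComp_diag_none]
    have := congrFun hb p
    simp only [Function.comp_apply] at this
    simp only [this]
    have := hne _ _ p.2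
    field_simp
  · change component (formPullback (diagFrame hk) (curvForm n (b, s))) (some _) _ _ = v m q
    rw [hcomp, diagFrame_single, diagFrame_single, curvComp_diag_some]
    simp only [hs]
    have := hne _ _ q.2.1
    field_simp
    ring

/-- The rank of the restriction to subspaces of dimension `k ≤ n` is at most the dimension of the
space of forms on the diagonal frame satisfying the first Bianchi identity: the rank does not
decrease under small perturbations towards the diagonal frame, and for almost all of these the
first Bianchi identity has at least as large a rank as for the diagonal frame. -/
theorem finrank_map_formPullback_le (hk : k ≤ n) (e : (Fin k → ℝ) →ₗ[ℝ] (Fin n → ℂ)) :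
    finrank ℝ ((integrableCurvature n).map (formPullback e)) ≤
      Fintype.card (PairIndex k) + n * Fintype.card (TripleIndex hk) := by
  -- all the components of a form on `ℝᵏ`, so that ranks are those of maps to a space `ℝ^ι`
  let C : CircleGLForm n (Fin k → ℝ) →ₗ[ℝ]
      ((Fin k × Fin k) × Option (Fin n × Fin n) → ℝ) :=
    { toFun := fun κ q => component κ q.2 (Pi.single q.1.1 1) (Pi.single q.1.2 1)
      map_add' := fun κ μ => by ext; simp [component]
      map_smul' := fun c κ => by ext; simp [component] }
  have hC : Function.Injective C := (injective_iff_map_eq_zero _).2 fun κ h =>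
    component_ext_zero fun o i j _ => congrFun h ((i, j), o)
  have hrange : ∀ f : (Fin k → ℝ) →ₗ[ℝ] (Fin n → ℂ),
      finrank ℝ ((integrableCurvature n).map (formPullback f)) =
        finrank ℝ (LinearMap.range (C ∘ₗ formPullback f ∘ₗ curvForm n)) := by
    intro f
    have h : (integrableCurvature n).map (formPullback f) =
        LinearMap.range (formPullback f ∘ₗ curvForm n) := by
      rw [LinearMap.range_comp]
      congr 1
      ext κ
      exact ⟨fun h => exists_curvForm_eq h, fun ⟨p, hp⟩ => hp ▸ curvForm_mem p⟩
    rw [h, LinearMap.range_comp (formPullback f ∘ₗ curvForm n) C]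
    exact (Submodule.equivMapOfInjective C hC _).finrank_eq
  have hev := eventually_finrank_range_le
    (fun t => C ∘ₗ formPullback (e + t • diagFrame hk) ∘ₗ curvForm n) (by
      intro p
      refine continuous_pi fun q => ?_
      have : ∀ t : ℝ, (C ∘ₗ formPullback (e + t • diagFrame hk) ∘ₗ curvForm n) p q =
          curvComp p (e (Pi.single q.1.1 1) + t • diagFrame hk (Pi.single q.1.1 1))
            (e (Pi.single q.1.2 1) + t • diagFrame hk (Pi.single q.1.2 1)) q.2 := by
        intro t
        change component (formPullback _ (curvForm n p)) _ _ _ = _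
        rw [component, formPullback_apply]
        exact component_curvForm _ _ _ _
      simp only [this, curvComp_add_left, curvComp_add_right, curvComp_smul_left,
        curvComp_smul_right, Pi.add_apply, Pi.smul_apply, smul_eq_mul]
      fun_prop)
  have hfin := finite_finrank_ker_lt (Y := CircleGLForm n (Fin k → ℝ)) (frameBianchi e)
    (frameBianchi (diagFrame hk))
  have hev' : ∀ᶠ t : ℝ in nhdsWithin 0 {0}ᶜ,
      finrank ℝ (LinearMap.ker (frameBianchi (e + t • diagFrame hk))) ≤
        finrank ℝ (LinearMap.ker (frameBianchi (diagFrame hk))) := by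
    filter_upwards [nhdsNE_le_cofinite 0 hfin.compl_mem_cofinite] with t ht
    rw [frameBianchi_add_smul]
    exact not_lt.1 ht
  obtain ⟨t, ht₁, ht₂⟩ := (hev.filter_mono nhdsWithin_le_nhds |>.and hev').exists
  have h0 : finrank ℝ ((integrableCurvature n).map (formPullback e)) ≤
      finrank ℝ ((integrableCurvature n).map (formPullback (e + t • diagFrame hk))) := by
    rw [hrange, hrange]
    have h : e + (0 : ℝ) • diagFrame hk = e := by ext; simp
    rwa [h] at ht₁
  have h1 : (integrableCurvature n).map (formPullback (e + t • diagFrame hk)) ≤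
      LinearMap.ker (frameBianchi (e + t • diagFrame hk)) := by
    rintro _ ⟨κ, hκ, rfl⟩
    exact formPullback_mem_ker _ hκ
  exact h0.trans ((finrank_le_finrank_ker (Y := CircleGLForm n (Fin k → ℝ)) h1).trans
    (ht₂.trans (finrank_ker_frameBianchi_diagFrame_le hk)))

end Frame

section Characters

theorem sum_range_mul_sub (n : ℕ) :
    ∑ j ∈ Finset.range (n + 1), j * (n + 1 - j) = (n + 2).choose 3 := by
  induction n with
  | zero => decide
  | succ n ih =>
    have h : ∀ j ∈ Finset.range (n + 1), j * (n + 1 + 1 - j) = j * (n + 1 - j) + j := by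
      intro j hj
      rw [Finset.mem_range] at hj
      rw [show n + 1 + 1 - j = (n + 1 - j) + 1 by omega]
      ring
    have h2 := Finset.sum_range_id_mul_two (n + 1)
    rw [Finset.sum_range_succ, Finset.sum_congr rfl h, Finset.sum_add_distrib, ih,
      Nat.choose_succ_succ (n + 2) 2, Finset.sum_range_id, ← Nat.choose_two_right,
      Nat.choose_succ_succ (n + 1) 1, Nat.choose_one_right, show n + 1 + 1 - (n + 1) = 1 by omega]
    ring

theorem sum_range_succ_mul (n : ℕ) :
    ∑ j ∈ Finset.range (n + 1), (j + 1) * j = 2 * (n + 2).choose 3 := by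
  induction n with
  | zero => decide
  | succ n ih =>
    rw [Finset.sum_range_succ, ih, Nat.choose_succ_succ (n + 2) 2, Nat.choose_two_right]
    have := Nat.div_mul_cancel (Nat.even_mul_pred_self (n + 2)).two_dvd
    simp only [Nat.succ_eq_add_one, show n + 2 - 1 = n + 1 by omega] at this ⊢
    linarith

theorem sum_range_succ_mul_mul_sub (n : ℕ) :
    ∑ j ∈ Finset.range (n + 1), (j + 1) * (j * (n + 1 - j)) = 2 * (n + 3).choose 4 := by
  induction n with
  | zero => decide
  | succ n ih =>
    have h : ∀ j ∈ Finset.range (n + 1),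
        (j + 1) * (j * (n + 1 + 1 - j)) = (j + 1) * (j * (n + 1 - j)) + (j + 1) * j := by
      intro j hj
      rw [Finset.mem_range] at hj
      rw [show n + 1 + 1 - j = (n + 1 - j) + 1 by omega]
      ring
    have h2 := sum_range_succ_mul (n + 1)
    rw [Finset.sum_range_succ] at h2
    rw [Finset.sum_range_succ, Finset.sum_congr rfl h, Finset.sum_add_distrib, ih,
      Nat.choose_succ_succ (n + 3) 3, show n + 1 + 1 - (n + 1) = 1 by omega]
    simp only [Nat.succ_eq_add_one] at h2 ⊢
    linarith

variable {n : ℕ} [NeZero n]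

theorem finiteDimensional_integrableCurvature : Module.Finite ℝ (integrableCurvature n) :=
  Module.Finite.equiv (curvEquiv n)

/-- The diagonal frame realizes the upper bound for the rank of the restriction to subspaces of
dimension `k ≤ n`. -/
theorem genericRank_of_le {k : ℕ} (hk : k ≤ n) : (integrableCurvature n).genericRank k =
    ∑ j ∈ Finset.range k, (j + n * (j * (n + 1 - j))) := by
  have hE : finrank ℝ (Fin n → ℂ) = 2 * n := by
    simp [finrank_pi_fintype, Complex.finrank_real_complex, mul_comm]
  have hcard : ∑ j ∈ Finset.range k, (j + n * (j * (n + 1 - j))) =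
      Fintype.card (PairIndex k) + n * Fintype.card (TripleIndex hk) := by
    rw [card_pairIndex, card_tripleIndex, Finset.sum_add_distrib, Finset.mul_sum]
  rw [hcard]
  refine genericRank_eq (by omega) (finrank_map_formPullback_le hk)
    ⟨LinearMap.range (diagFrame hk), ?_, ?_⟩
  · exact (LinearMap.finrank_range_le _).trans (by simp)
  have h1 := finrank_map_formPullback_comp_le (integrableCurvature n)
    (LinearMap.range (diagFrame hk)).subtype (diagFrame hk).rangeRestrict
  rw [← restrict_eq_formPullback, LinearMap.subtype_comp_codRestrict] at h1
  refine le_trans ?_ h1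
  have h3 : ((integrableCurvature n).map (formPullback (diagFrame hk))).map (frameCoord hk) =
      ⊤ := by
    refine Submodule.eq_top_iff'.2 fun u => ?_
    obtain ⟨p, hp⟩ := frameCoord_comp_surjective hk u
    exact ⟨_, ⟨_, curvForm_mem p, rfl⟩, hp⟩
  have h2 := finrank_le_of_map_eq_top (Y := CircleGLForm n (Fin k → ℝ)) h3
  simpa only [finrank_prod, finrank_pi_fintype, finrank_self, Finset.sum_const, Finset.card_univ,
      Fintype.card_fin, smul_eq_mul, mul_one] using h2

/-- A vector that, together with the diagonal frame, detects all curvature tensors. -/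
noncomputable def imOnes (n : ℕ) : Fin n → ℂ := fun _ => Complex.I

omit [NeZero n] in
theorem reL_imOnes : reL n (imOnes n) = 0 := by ext i; simp [reL_apply, imOnes]

omit [NeZero n] in
theorem imL_imOnes (i : Fin n) : imL n (imOnes n) i = 1 := by simp [imL_apply, imOnes]

omit [NeZero n] in
/-- A curvature tensor that vanishes on the span of the vectors `(1 + i j) e_j` and `∑ i e_j` is
zero. -/
theorem eq_zero_of_curvComp_diag {p : SymPair n}
    (h₁ : ∀ i j o, curvComp p (reVec i + (i : ℝ) • imVec i) (reVec j + (j : ℝ) • imVec j) o = 0)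
    (h₂ : ∀ i o, curvComp p (reVec i + (i : ℝ) • imVec i) (imOnes n) o = 0) : p = 0 := by
  have hne : ∀ i j : Fin n, i ≠ j → ((j : ℕ) : ℝ) - (i : ℕ) ≠ 0 := by
    intro i j hij
    rw [sub_ne_zero]
    exact_mod_cast fun h : (j : ℕ) = i => hij (Fin.ext h.symm)
  have hb : ∀ i j, i ≠ j → p.1 (i ::ₛ j ::ₛ Sym.nil) = 0 := by
    intro i j hij
    have h := h₁ i j none
    rw [curvComp_diag_none] at h
    exact (mul_eq_zero.1 h).resolve_left (hne i j hij)
  have hb' : ∀ i, p.1 (i ::ₛ i ::ₛ Sym.nil) = 0 := by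
    intro i
    have h := h₂ i none
    rw [curvComp_none, reL_diag, imL_diag, reL_imOnes, ← bil_sum_left] at h
    simp only [bil_single, imL_imOnes, mul_one] at h
    rw [Finset.sum_eq_single i (fun j _ hj => hb i j hj.symm) (by simp)] at h
    simpa [bil] using h
  have hp : p.1 = 0 := by
    refine funext <| Sym.two_cases fun i j => ?_
    by_cases hij : i = j
    · subst hij; exact hb' i
    · exact hb i j hij
  have hs : ∀ m i j l, i ≠ j → p.2 m (i ::ₛ j ::ₛ l ::ₛ Sym.nil) = 0 := by
    intro m i j l hij
    have h := h₁ i j (some (m, l))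
    rw [curvComp_diag_some, hp] at h
    simp only [Pi.zero_apply, zero_mul, sub_zero, mul_zero, add_zero] at h
    exact (mul_eq_zero.1 h).resolve_left (hne i j hij)
  have hs' : ∀ m i l, p.2 m (i ::ₛ i ::ₛ l ::ₛ Sym.nil) = 0 := by
    intro m i l
    have h := h₂ i (some (m, l))
    simp only [curvComp, reL_diag, imL_diag, reL_imOnes, hp] at h
    rw [tril_swap_right, ← tril_sum_left] at h
    simp only [tril_single, imL_imOnes, mul_one, Sym.cons_swap l] at h
    rw [Finset.sum_eq_single i (fun j _ hj => hs m i j l hj.symm) (by simp)] at h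
    simpa [bil, tril] using h
  refine Prod.ext hp (funext fun m => funext <| Sym.three_cases fun i j l => ?_)
  by_cases hij : i = j
  · subst hij; exact hs' m i l
  · exact hs m i j l hij

/-- The restriction to a generic subspace of dimension `k > n` is injective. -/
theorem genericRank_of_lt {k : ℕ} (hk : n < k) (hk' : k ≤ 2 * n) :
    (integrableCurvature n).genericRank k = finrank ℝ (integrableCurvature n) := by
  have hE : finrank ℝ (Fin n → ℂ) = 2 * n := by
    simp [finrank_pi_fintype, Complex.finrank_real_complex, mul_comm]
  have := finiteDimensional_integrableCurvature (n := n)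
  set v : Option (Fin n) → Fin n → ℂ :=
    fun o => o.elim (imOnes n) fun i => reVec i + (i : ℝ) • imVec i
  set F := Submodule.span ℝ (Set.range v)
  refine genericRank_eq (by omega) (fun e => Submodule.finrank_map_le _ _) ⟨F, ?_, ?_⟩
  · refine (finrank_range_le_card v).trans ?_
    simpa using hk
  have hinj : Function.Injective
      ((SecondLevelTableau.restrict F ∘ₗ (integrableCurvature n).subtype) ∘ₗ
        (curvEquiv n).toLinearMap) := by
    refine (injective_iff_map_eq_zero _).2 fun p hp => ?_
    have h : ∀ o o' q, curvComp p (v o) (v o') q = 0 := by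
      intro o o' q
      have h1 : formPullback F.subtype (curvForm n p) = 0 := hp
      rw [← component_curvForm, component]
      have h2 := formPullback_apply F.subtype (curvForm n p)
        ⟨v o, Submodule.subset_span ⟨o, rfl⟩⟩ ⟨v o', Submodule.subset_span ⟨o', rfl⟩⟩
      rw [h1] at h2
      change 0 = curvForm n p ![v o, v o'] at h2
      rw [← h2, map_zero]
      rfl
    exact eq_zero_of_curvComp_diag (fun i j => h (some i) (some j)) (fun i => h (some i) none)
  have hr := LinearMap.finrank_range_of_inj hinj
  rw [LinearEquiv.range_comp, LinearMap.range_comp, Submodule.range_subtype,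
    (curvEquiv n).finrank_eq] at hr
  exact hr.ge

/-- The value of the generic rank, for all dimensions of subspaces. -/
theorem genericRank_eq_sum {k : ℕ} (hk : k ≤ 2 * n) : (integrableCurvature n).genericRank k =
    ∑ j ∈ Finset.range (min k (n + 1)), (j + n * (j * (n + 1 - j))) := by
  rcases Nat.lt_or_ge n k with h | h
  · rw [genericRank_of_lt h hk, finrank_integrableCurvature, min_eq_right h,
      Finset.sum_add_distrib, ← Finset.mul_sum, sum_range_mul_sub, Finset.sum_range_id,
      ← Nat.choose_two_right, Nat.multichoose_eq, Nat.multichoose_eq]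
    rfl
  · rw [genericRank_of_le h, min_eq_left (by omega)]

theorem cartanCharacter_zero : (integrableCurvature n).cartanCharacter 0 = 0 := by
  rw [SecondLevelTableau.cartanCharacter, genericRank_eq_sum (Nat.zero_le _)]
  simp

theorem cartanCharacter_succ {k : ℕ} (hk : k + 1 ≤ 2 * n) :
    (integrableCurvature n).cartanCharacter (k + 1) =
      if k ≤ n then ((k + n * (k * (n + 1 - k)) : ℕ) : ℤ) else 0 := by
  rw [SecondLevelTableau.cartanCharacter, genericRank_eq_sum hk, genericRank_eq_sum (by omega)]
  split_ifs with h
  · rw [min_eq_left (by omega), min_eq_left (by omega), Finset.sum_range_succ]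
    push_cast
    ring
  · rw [min_eq_right (by omega), min_eq_right (by omega), sub_self]

theorem cartanCharacter_eq {k : ℕ} (hk : k ≤ 2 * n) :
    (integrableCurvature n).cartanCharacter k =
      if 2 ≤ k ∧ k ≤ n + 1 then
        (k : ℤ) - 1 + (n : ℤ) * ((n : ℤ) + ((k : ℤ) - 2) * ((n : ℤ) + 1 - (k : ℤ)))
      else 0 := by
  obtain _ | k := k
  · simpa using cartanCharacter_zero
  rw [cartanCharacter_succ hk]
  by_cases h : k ≤ n
  · rw [if_pos h]
    obtain _ | k := k
    · simp
    · rw [if_pos (by omega)]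
      rw [show n + 1 - (k + 1) = n - k by omega]
      push_cast [Nat.cast_sub (show k ≤ n by omega)]
      ring
  · rw [if_neg h, if_neg (by omega)]

/-- Cartan's test: the dimension of the prolongation and `∑ k s_k` are both equal to
`2 (n + 2).choose 3 + 2 n (n + 3).choose 4`. -/
theorem isInvolutive_integrableCurvature : (integrableCurvature n).IsInvolutive := by
  have hE : finrank ℝ (Fin n → ℂ) = 2 * n := by
    simp [finrank_pi_fintype, Complex.finrank_real_complex, mul_comm]
  have hn : 0 < n := Nat.pos_of_neZero n
  rw [SecondLevelTableau.IsInvolutive, finrank_prolongation, hE, Finset.sum_range_succ']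
  have h1 : ∀ k ∈ Finset.range (2 * n), ((k + 1 : ℕ) : ℤ) *
      (integrableCurvature n).cartanCharacter (k + 1) =
      if k ≤ n then (((k + 1) * (k + n * (k * (n + 1 - k))) : ℕ) : ℤ) else 0 := by
    intro k hk
    rw [cartanCharacter_succ (Finset.mem_range.1 hk)]
    split_ifs
    · push_cast; ring
    · simp
  have h2 : (Finset.range (2 * n)).filter (fun k => k ≤ n) = Finset.range (n + 1) := by
    ext k
    simp only [Finset.mem_filter, Finset.mem_range]
    omega
  have h3 : ∑ k ∈ Finset.range (n + 1), (k + 1) * (k + n * (k * (n + 1 - k))) =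
      2 * n.multichoose 3 + 2 * (n * n.multichoose 4) := by
    simp only [mul_add, Finset.sum_add_distrib, sum_range_succ_mul, Nat.multichoose_eq]
    simp only [mul_left_comm _ n, ← Finset.mul_sum, sum_range_succ_mul_mul_sub]
    rfl
  rw [Finset.sum_congr rfl h1, ← Finset.sum_filter, cartanCharacter_zero, ← h3, h2, mul_zero,
    add_zero, Nat.cast_sum]

end Characters

/-! ### The characteristic variety -/

section Covectors

variable {𝕜 : Type*} [Field 𝕜] [Algebra ℝ 𝕜] {n : ℕ}

theorem tensorCovector_reVec (l : ℂ →ₗ[ℝ] 𝕜) (ξ : (Fin n → ℝ) →ₗ[ℝ] 𝕜) (i : Fin n) :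
    tensorCovector l ξ (reVec i) = l 1 * ξ (Pi.single i 1) := by
  rw [← tensorCovector_apply]
  congr 1
  ext k
  by_cases h : k = i <;> simp [reVec, h]

theorem tensorCovector_imVec (l : ℂ →ₗ[ℝ] 𝕜) (ξ : (Fin n → ℝ) →ₗ[ℝ] 𝕜) (i : Fin n) :
    tensorCovector l ξ (imVec i) = l Complex.I * ξ (Pi.single i 1) := by
  rw [← tensorCovector_apply]
  congr 1
  ext k
  by_cases h : k = i <;> simp [imVec, h]

theorem exists_linearMap_complex_eq (a b : 𝕜) : ∃ l : ℂ →ₗ[ℝ] 𝕜, l 1 = a ∧ l Complex.I = b :=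
  ⟨Complex.basisOneI.constr ℝ ![a, b],
    by simp, by simp⟩

theorem exists_linearMap_pi_eq (v : Fin n → 𝕜) :
    ∃ ξ : (Fin n → ℝ) →ₗ[ℝ] 𝕜, ∀ i, ξ (Pi.single i 1) = v i :=
  ⟨(Pi.basisFun ℝ (Fin n)).constr ℝ v, fun i => by simp⟩

/-- A covector is decomposable if its values on `ℝⁿ` and on `i ℝⁿ` are proportional. -/
theorem exists_tensorCovector_eq {ξ : (Fin n → ℂ) →ₗ[ℝ] 𝕜}
    (h : ∀ i j, ξ (reVec i) * ξ (imVec j) = ξ (reVec j) * ξ (imVec i)) :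
    ∃ (l : ℂ →ₗ[ℝ] 𝕜) (ξ' : (Fin n → ℝ) →ₗ[ℝ] 𝕜), ξ = tensorCovector l ξ' := by
  by_cases h1 : ∃ p, ξ (reVec p) ≠ 0
  · obtain ⟨p, hp⟩ := h1
    obtain ⟨l, hl1, hlI⟩ := exists_linearMap_complex_eq 1 (ξ (imVec p) / ξ (reVec p))
    obtain ⟨ξ', hξ'⟩ := exists_linearMap_pi_eq fun i => ξ (reVec i)
    refine ⟨l, ξ', LinearMap.ext_realBasis (fun i => ?_) fun i => ?_⟩
    · rw [tensorCovector_reVec, hl1, hξ', one_mul]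
    · rw [tensorCovector_imVec, hlI, hξ', div_mul_eq_mul_div, eq_div_iff hp]
      linear_combination h p i
  · push Not at h1
    obtain ⟨l, hl1, hlI⟩ := exists_linearMap_complex_eq (0 : 𝕜) 1
    obtain ⟨ξ', hξ'⟩ := exists_linearMap_pi_eq fun i => ξ (imVec i)
    refine ⟨l, ξ', LinearMap.ext_realBasis (fun i => ?_) fun i => ?_⟩
    · rw [tensorCovector_reVec, hl1, h1, zero_mul]
    · rw [tensorCovector_imVec, hlI, hξ', one_mul]

omit [Algebra ℝ 𝕜] in
/-- If `B ⊗ ε = ξ ∧ u` for a symmetric bilinear form `B` and the area form `ε` of `ℝ²`, and if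
`ξ` has independent components `α` and `β`, then `B = 0`. Here `B` has the components
`α_i δ_j - β_j γ_i`. -/
theorem eq_zero_of_symm_wedge {ι : Type*} {α β γ δ : ι → 𝕜} {p q : ι}
    (hpq : α p * β q ≠ α q * β p)
    (h₁ : ∀ i j, α i * γ j = α j * γ i) (h₂ : ∀ i j, β i * δ j = β j * δ i)
    (h₃ : ∀ i j, α i * δ j - β j * γ i = α j * δ i - β i * γ j) (i j : ι) :
    α i * δ j - β j * γ i = 0 := by
  obtain ⟨c, hc⟩ : ∃ c, ∀ i, γ i = c * α i := by
    by_cases hp : α p = 0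
    · have hq : α q ≠ 0 := fun hq => hpq (by rw [hp, hq]; ring)
      exact ⟨γ q / α q, fun i => by
        rw [div_mul_eq_mul_div, eq_div_iff hq]; linear_combination h₁ q i⟩
    · exact ⟨γ p / α p, fun i => by
        rw [div_mul_eq_mul_div, eq_div_iff hp]; linear_combination h₁ p i⟩
  obtain ⟨d, hd⟩ : ∃ d, ∀ i, δ i = d * β i := by
    by_cases hp : β p = 0
    · have hq : β q ≠ 0 := fun hq => hpq (by rw [hp, hq]; ring)
      exact ⟨δ q / β q, fun i => by
        rw [div_mul_eq_mul_div, eq_div_iff hq]; linear_combination h₂ q i⟩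
    · exact ⟨δ p / β p, fun i => by
        rw [div_mul_eq_mul_div, eq_div_iff hp]; linear_combination h₂ p i⟩
  have h : (d - c) * (α p * β q - α q * β p) = 0 := by
    have := h₃ p q
    simp only [hc, hd] at this
    linear_combination this
  have hcd : d = c := sub_eq_zero.1 ((mul_eq_zero.1 h).resolve_right (sub_ne_zero.2 hpq))
  rw [hc, hd, hcd]
  ring

end Covectors

section Characteristic

variable {𝕜 : Type*} [Field 𝕜] [Algebra ℝ 𝕜] {n : ℕ} [NeZero n]

/-- The basis of `𝔤` dual to the components. -/
noncomputable def circleGLBasis (n : ℕ) [NeZero n] :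
    Basis (Option (Fin n × Fin n)) ℝ (circleGL n) :=
  Basis.ofEquivFun (circleGLEquiv n)

/-- The components of the values of a form with values in `𝕜 ⊗ 𝔤`. -/
noncomputable def scalarComponent (o : Option (Fin n × Fin n)) (x y : Fin n → ℂ) :
    ((Fin n → ℂ) [⋀^Fin 2]→ₗ[ℝ] (𝕜 ⊗[ℝ] circleGL n)) →ₗ[𝕜] 𝕜 where
  toFun κ := ((circleGLBasis n).baseChange 𝕜).repr (κ ![x, y]) o
  map_add' κ μ := by rw [AlternatingMap.add_apply, map_add, Finsupp.add_apply]
  map_smul' c κ := by rw [AlternatingMap.smul_apply, map_smul, Finsupp.smul_apply]; rfl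

theorem scalarComponent_eq (o : Option (Fin n × Fin n)) (x y : Fin n → ℂ)
    (κ : (Fin n → ℂ) [⋀^Fin 2]→ₗ[ℝ] (𝕜 ⊗[ℝ] circleGL n)) :
    scalarComponent o x y κ = ((circleGLBasis n).baseChange 𝕜).repr (κ ![x, y]) o := rfl

variable (𝕜) in
/-- The extension of scalars of a form with values in `𝔤`. -/
noncomputable def scalarForm (p : SymPair n) :
    (Fin n → ℂ) [⋀^Fin 2]→ₗ[ℝ] (𝕜 ⊗[ℝ] circleGL n) :=
  (TensorProduct.mk ℝ 𝕜 (circleGL n) 1).compAlternatingMap (curvForm n p)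

theorem scalarComponent_scalarForm (p : SymPair n) (o : Option (Fin n × Fin n)) (x y : Fin n → ℂ) :
    scalarComponent o x y (scalarForm 𝕜 p) = algebraMap ℝ 𝕜 (curvComp p x y o) := by
  rw [scalarComponent_eq]
  change ((circleGLBasis n).baseChange 𝕜).repr (1 ⊗ₜ[ℝ] (curvForm n p ![x, y])) o = _
  rw [Basis.baseChange_repr_tmul, Algebra.smul_def, mul_one, ← component_curvForm]
  rfl

theorem scalarForm_mem (p : SymPair n) : scalarForm 𝕜 p ∈
    SecondLevelTableau.extendScalars 𝕜 (integrableCurvature n) :=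
  Submodule.subset_span ⟨_, curvForm_mem p, rfl⟩

/-- A linear relation between components that holds on `𝒦_∘(𝔤)` holds on `𝒦_∘(𝔤) ⊗ 𝕜`. -/
theorem eq_zero_of_scalarForm
    (L : ((Fin n → ℂ) [⋀^Fin 2]→ₗ[ℝ] (𝕜 ⊗[ℝ] circleGL n)) →ₗ[𝕜] 𝕜)
    (hL : ∀ p, L (scalarForm 𝕜 p) = 0) {κ : (Fin n → ℂ) [⋀^Fin 2]→ₗ[ℝ] (𝕜 ⊗[ℝ] circleGL n)}
    (hκ : κ ∈ SecondLevelTableau.extendScalars 𝕜 (integrableCurvature n)) : L κ = 0 := by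
  have : SecondLevelTableau.extendScalars 𝕜 (integrableCurvature n) ≤ LinearMap.ker L := by
    refine Submodule.span_le.2 ?_
    rintro _ ⟨μ, hμ, rfl⟩
    obtain ⟨p, rfl⟩ := exists_curvForm_eq hμ
    exact hL p
  exact this hκ

theorem scalar_ext {κ μ : (Fin n → ℂ) [⋀^Fin 2]→ₗ[ℝ] (𝕜 ⊗[ℝ] circleGL n)}
    (h₁ : ∀ o i j, scalarComponent o (reVec i) (reVec j) κ =
      scalarComponent o (reVec i) (reVec j) μ)
    (h₂ : ∀ o i j, scalarComponent o (reVec i) (imVec j) κ =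
      scalarComponent o (reVec i) (imVec j) μ)
    (h₃ : ∀ o i j, scalarComponent o (imVec i) (imVec j) κ =
      scalarComponent o (imVec i) (imVec j) μ) : κ = μ := by
  have h : ∀ x y : Fin n → ℂ, (∀ o, scalarComponent o x y κ = scalarComponent o x y μ) →
      κ ![x, y] = μ ![x, y] := fun x y hxy =>
    ((circleGLBasis n).baseChange 𝕜).repr.injective (Finsupp.ext hxy)
  exact AlternatingMap.ext_realBasis (fun i j => h _ _ fun o => h₁ o i j)
    (fun i j => h _ _ fun o => h₂ o i j) (fun i j => h _ _ fun o => h₃ o i j)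

/-- Characteristic covectors are decomposable: if `ξ` is not, the symmetry of `Ω` forces `Ω = 0`,
and then the symmetry of `Φ` forces `Φ = 0`. -/
theorem proportional_of_isCharacteristic {ξ : (Fin n → ℂ) →ₗ[ℝ] 𝕜}
    (h : SecondLevelTableau.IsCharacteristic 𝕜 (integrableCurvature n) ξ) (i j : Fin n) :
    ξ (reVec i) * ξ (imVec j) = ξ (reVec j) * ξ (imVec i) := by
  by_contra hne
  obtain ⟨κ, hκ, hκ0, u, hu⟩ := h
  set v : Option (Fin n × Fin n) → (Fin n → ℂ) → 𝕜 :=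
    fun o x => ((circleGLBasis n).baseChange 𝕜).repr (u x) o
  have hc : ∀ o x y, scalarComponent o x y κ = ξ x * v o y - ξ y * v o x := by
    intro o x y
    rw [scalarComponent_eq, hu, map_sub, map_smul, map_smul]
    rfl
  -- a component that vanishes on `ℝⁿ` and on `i ℝⁿ` and is symmetric between them vanishes
  have key : ∀ o, (∀ i j, scalarComponent o (reVec i) (reVec j) κ = 0) →
      (∀ i j, scalarComponent o (imVec i) (imVec j) κ = 0) →
      (∀ i j, scalarComponent o (reVec i) (imVec j) κ = scalarComponent o (reVec j) (imVec i) κ) →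
      ∀ i j, scalarComponent o (reVec i) (imVec j) κ = 0 := by
    intro o h1 h2 h3 k l
    simp only [hc] at h1 h2 h3 ⊢
    exact eq_zero_of_symm_wedge (α := fun i => ξ (reVec i)) (β := fun i => ξ (imVec i))
      (γ := fun i => v o (reVec i)) (δ := fun i => v o (imVec i)) hne
      (fun i j => sub_eq_zero.1 (h1 i j)) (fun i j => sub_eq_zero.1 (h2 i j)) h3 k l
  have hΩr : ∀ i j, scalarComponent none (reVec i) (reVec j) κ = 0 := fun i j =>
    eq_zero_of_scalarForm _ (fun p => by
      rw [scalarComponent_scalarForm, curvComp_reVec_reVec_none, map_zero]) hκ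
  have hΩi : ∀ i j, scalarComponent none (imVec i) (imVec j) κ = 0 := fun i j =>
    eq_zero_of_scalarForm _ (fun p => by
      rw [scalarComponent_scalarForm, curvComp_imVec_imVec_none, map_zero]) hκ
  have hΩ : ∀ i j, scalarComponent none (reVec i) (imVec j) κ = 0 := by
    refine key none hΩr hΩi fun i j => ?_
    have := eq_zero_of_scalarForm
      (scalarComponent none (reVec i) (imVec j) - scalarComponent none (reVec j) (imVec i))
      (fun p => by
        rw [LinearMap.sub_apply, scalarComponent_scalarForm, scalarComponent_scalarForm,
          curvComp_reVec_imVec_none, curvComp_reVec_imVec_none, Sym.cons_swap, sub_self]) hκ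
    exact sub_eq_zero.1 this
  have hΦr : ∀ m l i j, scalarComponent (some (m, l)) (reVec i) (reVec j) κ = 0 := by
    intro m l i j
    have := eq_zero_of_scalarForm (scalarComponent (some (m, l)) (reVec i) (reVec j)
      - ((algebraMap ℝ 𝕜 ((Pi.single j 1 : Fin n → ℝ) m)) • scalarComponent none (reVec i) (imVec l)
        - (algebraMap ℝ 𝕜 ((Pi.single i 1 : Fin n → ℝ) m)) •
          scalarComponent none (reVec j) (imVec l))) (fun p => by
        simp only [LinearMap.sub_apply, LinearMap.smul_apply, scalarComponent_scalarForm,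
          curvComp_reVec_imVec_none, curvComp_reVec_reVec_some, map_sub, map_mul, smul_eq_mul]
        ring) hκ
    simpa only [LinearMap.sub_apply, LinearMap.smul_apply, hΩ, smul_zero, sub_zero] using this
  have hΦi : ∀ m l i j, scalarComponent (some (m, l)) (imVec i) (imVec j) κ = 0 := by
    intro m l i j
    have := eq_zero_of_scalarForm (scalarComponent (some (m, l)) (imVec i) (imVec j)
      - ((algebraMap ℝ 𝕜 ((Pi.single j 1 : Fin n → ℝ) m)) • scalarComponent none (reVec i) (imVec l)
        - (algebraMap ℝ 𝕜 ((Pi.single i 1 : Fin n → ℝ) m)) •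
          scalarComponent none (reVec j) (imVec l))) (fun p => by
        simp only [LinearMap.sub_apply, LinearMap.smul_apply, scalarComponent_scalarForm,
          curvComp_reVec_imVec_none, curvComp_imVec_imVec_some, map_sub, map_mul, smul_eq_mul]
        ring) hκ
    simpa only [LinearMap.sub_apply, LinearMap.smul_apply, hΩ, smul_zero, sub_zero] using this
  have hΦ : ∀ m l i j, scalarComponent (some (m, l)) (reVec i) (imVec j) κ = 0 := by
    intro m l
    refine key _ (hΦr m l) (hΦi m l) fun i j => ?_
    have := eq_zero_of_scalarForm (scalarComponent (some (m, l)) (reVec i) (imVec j)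
        - scalarComponent (some (m, l)) (reVec j) (imVec i)) (fun p => by
        rw [LinearMap.sub_apply, scalarComponent_scalarForm, scalarComponent_scalarForm,
          curvComp_reVec_imVec_some, curvComp_reVec_imVec_some, Sym.cons_swap, sub_self]) hκ
    exact sub_eq_zero.1 this
  refine hκ0 (scalar_ext ?_ ?_ ?_)
  · rintro (_ | ⟨m, l⟩) i j
    · rw [hΩr, map_zero]
    · rw [hΦr, map_zero]
  · rintro (_ | ⟨m, l⟩) i j
    · rw [hΩ, map_zero]
    · rw [hΦ, map_zero]
  · rintro (_ | ⟨m, l⟩) i j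
    · rw [hΩi, map_zero]
    · rw [hΦi, map_zero]

/-- Decomposable covectors `l ⊗ ξ` are characteristic: for a covector `l'` on `ℂ` with
`l ∧ l' = ε`, the form with `B = 0` and `S = ξ³ ⊗ e_0` is the product of `l ⊗ ξ` and
`(l' ⊗ ξ) ⊗ (ξ ⊗ e_0)`. -/
theorem isCharacteristic_tensorCovector {l : ℂ →ₗ[ℝ] 𝕜} {ξ : (Fin n → ℝ) →ₗ[ℝ] 𝕜}
    (h : tensorCovector l ξ ≠ 0) :
    SecondLevelTableau.IsCharacteristic 𝕜 (integrableCurvature n) (tensorCovector l ξ) := by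
  set a : Fin n → 𝕜 := fun i => ξ (Pi.single i 1) with ha
  obtain ⟨k, hk⟩ : ∃ k, a k ≠ 0 := by
    by_contra! h0
    refine h (LinearMap.ext_realBasis (fun i => ?_) fun i => ?_)
    · rw [tensorCovector_reVec]; exact mul_eq_zero_of_right _ (h0 i)
    · rw [tensorCovector_imVec]; exact mul_eq_zero_of_right _ (h0 i)
  obtain ⟨l', hl'⟩ : ∃ l' : ℂ →ₗ[ℝ] 𝕜, l 1 * l' Complex.I - l Complex.I * l' 1 = 1 := by
    by_cases h1 : l 1 = 0
    · have hI : l Complex.I ≠ 0 := fun hI => h (LinearMap.ext_realBasis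
        (fun i => by rw [tensorCovector_reVec, h1, zero_mul]; rfl)
        (fun i => by rw [tensorCovector_imVec, hI, zero_mul]; rfl))
      obtain ⟨l', h2, h3⟩ := exists_linearMap_complex_eq (-(l Complex.I)⁻¹) 0
      exact ⟨l', by rw [h2, h3]; field_simp; ring⟩
    · obtain ⟨l', h2, h3⟩ := exists_linearMap_complex_eq 0 (l 1)⁻¹
      exact ⟨l', by rw [h2, h3]; field_simp; ring⟩
  -- `ξ³ ⊗ e_0` has coefficients in `𝕜`, so it is written as a combination of real tensors
  set κ : (Fin n → ℂ) [⋀^Fin 2]→ₗ[ℝ] (𝕜 ⊗[ℝ] circleGL n) :=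
    ∑ M : Sym (Fin n) 3, ((M : Multiset (Fin n)).map a).prod •
      scalarForm 𝕜 (0, Pi.single 0 (Pi.single M 1)) with hκ
  have hcomp : ∀ o x y, scalarComponent o x y κ = ∑ M : Sym (Fin n) 3,
      ((M : Multiset (Fin n)).map a).prod *
        algebraMap ℝ 𝕜 (curvComp (0, Pi.single 0 (Pi.single M 1)) x y o) := by
    intro o x y
    rw [hκ, map_sum]
    refine Finset.sum_congr rfl fun M _ => ?_
    rw [map_smul, scalarComponent_scalarForm, smul_eq_mul]
  have hri : ∀ m l i j, scalarComponent (some (m, l)) (reVec i) (imVec j) κ =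
      if m = 0 then a i * a j * a l else 0 := by
    intro m l i j
    rw [hcomp]
    simp only [curvComp_reVec_imVec_some]
    split_ifs with hm
    · subst hm
      rw [Finset.sum_eq_single (i ::ₛ j ::ₛ l ::ₛ Sym.nil)]
      · simp only [Sym.coe_cons, Sym.coe_nil, Multiset.map_cons, Multiset.map_zero,
          Multiset.prod_cons, Multiset.prod_zero, mul_one, Pi.single_eq_same, map_one, mul_assoc]
      · intro M _ hM
        rw [Pi.single_eq_same, Pi.single_eq_of_ne hM.symm, map_zero, mul_zero]
      · simp
    · refine Finset.sum_eq_zero fun M _ => ?_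
      rw [Pi.single_eq_of_ne hm, Pi.zero_apply, map_zero, mul_zero]
  set u : (Fin n → ℂ) →ₗ[ℝ] (𝕜 ⊗[ℝ] circleGL n) :=
    ∑ j, ((LinearMap.toSpanSingleton 𝕜 (𝕜 ⊗[ℝ] circleGL n)
      (a j • (1 ⊗ₜ[ℝ] circleGLBasis n (some (0, j))))).restrictScalars ℝ) ∘ₗ tensorCovector l' ξ
    with hu
  have hucomp : ∀ o x, ((circleGLBasis n).baseChange 𝕜).repr (u x) o =
      o.elim 0 fun q => if q.1 = 0 then tensorCovector l' ξ x * a q.2 else 0 := by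
    intro o x
    simp only [hu, LinearMap.sum_apply, LinearMap.comp_apply, LinearMap.restrictScalars_apply,
      LinearMap.toSpanSingleton_apply, map_sum, map_smul, Finsupp.finsetSum_apply,
      Finsupp.smul_apply, Basis.baseChange_repr_tmul, Basis.repr_self, smul_eq_mul]
    rcases o with _ | ⟨m, q⟩
    · simp
    · rw [Finset.sum_eq_single q]
      · by_cases hm : m = 0
        · simp [hm]
        · simp [hm]
      · intro j _ hj
        simp [hj]
      · simp
  refine ⟨κ, Submodule.sum_mem _ fun M _ => Submodule.smul_mem _ _ (scalarForm_mem _), ?_, u, ?_⟩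
  · intro h0
    have := hri 0 k k k
    rw [h0, map_zero, if_pos rfl] at this
    exact mul_ne_zero (mul_ne_zero hk hk) hk this.symm
  obtain ⟨β, hβ⟩ : ∃ β : (Fin n → ℂ) →ₗ[ℝ] (Fin n → ℂ) →ₗ[ℝ] (𝕜 ⊗[ℝ] circleGL n),
      ∀ x y, β x y = tensorCovector l ξ x • u y - tensorCovector l ξ y • u x :=
    ⟨LinearMap.mk₂ ℝ
      (fun x y => tensorCovector l ξ x • u y - tensorCovector l ξ y • u x)
      (fun x y z => by rw [map_add, map_add, add_smul, smul_add]; abel)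
      (fun c x y => by
        rw [map_smul, map_smul, smul_assoc, smul_sub, smul_comm (tensorCovector l ξ y) c])
      (fun x y z => by rw [map_add, map_add, add_smul, smul_add]; abel)
      (fun c x y => by
        rw [map_smul, map_smul, smul_assoc, smul_sub, smul_comm (tensorCovector l ξ x) c]),
      fun _ _ => rfl⟩
  have hβ0 : ∀ x, β x x = 0 := fun x => (hβ x x).trans (sub_self _)
  have hwedge : κ = alternatingOfBilin β hβ0 := by
    have hr : ∀ o x y, scalarComponent o x y (alternatingOfBilin β hβ0) =
        o.elim 0 fun q => if q.1 = 0 then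
          (tensorCovector l ξ x * tensorCovector l' ξ y
            - tensorCovector l ξ y * tensorCovector l' ξ x) * a q.2 else 0 := by
      intro o x y
      rw [scalarComponent_eq, alternatingOfBilin_apply, hβ, map_sub, map_smul, map_smul,
        Finsupp.sub_apply, Finsupp.smul_apply, Finsupp.smul_apply, hucomp, hucomp]
      rcases o with _ | ⟨m, q⟩
      · simp
      · simp only [Option.elim_some, smul_eq_mul]
        split_ifs <;> ring
    refine scalar_ext (fun o i j => ?_) (fun o i j => ?_) (fun o i j => ?_)
    · rw [hr, hcomp]
      rcases o with _ | ⟨m, q⟩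
      · simp [curvComp_reVec_reVec_none]
      · simp only [curvComp_reVec_reVec_some, Pi.zero_apply, zero_mul, sub_zero, map_zero, mul_zero,
          Finset.sum_const_zero, Option.elim_some, tensorCovector_reVec]
        split_ifs <;> ring
    · rw [hr]
      rcases o with _ | ⟨m, q⟩
      · rw [hcomp]
        simp [curvComp_reVec_imVec_none]
      · rw [hri]
        simp only [Option.elim_some, tensorCovector_reVec, tensorCovector_imVec]
        split_ifs
        · linear_combination (-(a i * a j * a q)) * hl'
        · rfl
    · rw [hr, hcomp]
      rcases o with _ | ⟨m, q⟩
      · simp [curvComp_imVec_imVec_none]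
      · simp only [curvComp_imVec_imVec_some, Pi.zero_apply, zero_mul, sub_zero, map_zero, mul_zero,
          Finset.sum_const_zero, Option.elim_some, tensorCovector_imVec]
        split_ifs <;> ring
  intro x y
  rw [hwedge, alternatingOfBilin_apply, hβ]

variable (𝕜) in
/-- The points of the characteristic variety are the decomposable covectors. -/
theorem characteristicVariety_eq :
    SecondLevelTableau.characteristicVariety 𝕜 (integrableCurvature n) =
      decomposableCovectors 𝕜 n := by
  ext p
  constructor
  · intro hp
    obtain ⟨l, ξ', h⟩ := exists_tensorCovector_eq
      (proportional_of_isCharacteristic hp)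
    refine ⟨l, ξ', h ▸ p.rep_nonzero, ?_⟩
    conv_lhs => rw [← p.mk_rep]
    simp only [h]
  · rintro ⟨l, ξ', h0, hp⟩
    rw [← p.mk_rep, Projectivization.mk_eq_mk_iff'] at hp
    obtain ⟨c, hc⟩ := hp
    have h : p.rep = tensorCovector (c • l) ξ' := by
      rw [← hc]
      refine LinearMap.ext_realBasis (fun i => ?_) fun i => ?_
      · rw [tensorCovector_reVec, LinearMap.smul_apply, LinearMap.smul_apply, tensorCovector_reVec,
          smul_mul_assoc]
      · rw [tensorCovector_imVec, LinearMap.smul_apply, LinearMap.smul_apply, tensorCovector_imVec,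
          smul_mul_assoc]
    have h1 : tensorCovector (c • l) ξ' ≠ 0 := h ▸ p.rep_nonzero
    change SecondLevelTableau.IsCharacteristic 𝕜 (integrableCurvature n) p.rep
    rw [h]
    exact isCharacteristic_tensorCovector h1

end Characteristic

/-! ### The degree of the Segre cone -/

section Monomials

/-- Every multiset of cardinality `t` is the multiset of values of a family indexed by `Fin t`. -/
theorem Sym.exists_map_univ_eq {α : Type*} {t : ℕ} (s : Sym α t) :
    ∃ f : Fin t → α, (Finset.univ.val.map f : Multiset α) = s := by
  obtain ⟨m, hm⟩ := s
  induction m using Quotient.inductionOn with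
  | h L =>
    obtain rfl : L.length = t := hm
    exact ⟨L.get, by rw [Fin.univ_val_map, List.ofFn_get]; rfl⟩

/-- Distinct monomials of degree `t` are linearly independent as functions. -/
theorem linearIndependent_monomial_functions (σ : Type*) [Fintype σ] (t : ℕ) :
    LinearIndependent ℂ
      (fun (s : Sym σ t) (x : σ → ℂ) => ((s : Multiset σ).map x).prod) := by
  classical
  let φ : MvPolynomial σ ℂ →ₗ[ℂ] ((σ → ℂ) → ℂ) :=
    { toFun := fun p x => MvPolynomial.eval x p
      map_add' := fun p q => by ext x; simp
      map_smul' := fun c p => by ext x; simp }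
  have hφ : LinearMap.ker φ = ⊥ := LinearMap.ker_eq_bot.2 fun p q h =>
    MvPolynomial.funext fun x => congrFun h x
  have h := ((MvPolynomial.basisMonomials σ ℂ).linearIndependent.comp
    (fun s : Sym σ t => Multiset.toFinsupp (s : Multiset σ))
    (Multiset.toFinsupp.injective.comp Sym.coe_injective)).map' φ hφ
  have hcomp : (fun (s : Sym σ t) (x : σ → ℂ) => ((s : Multiset σ).map x).prod) =
      φ ∘ MvPolynomial.basisMonomials σ ℂ ∘
        fun s : Sym σ t => Multiset.toFinsupp (s : Multiset σ) := by
    ext s x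
    simp only [φ, Function.comp_apply, MvPolynomial.coe_basisMonomials, LinearMap.coe_mk,
      AddHom.coe_mk, MvPolynomial.eval_monomial, one_mul]
    rw [Finsupp.prod, Multiset.toFinsupp_support, Finset.prod_multiset_map_count]
    simp only [Multiset.toFinsupp_apply]
  rw [hcomp]
  exact h

/-- Products of monomials in two separate sets of variables are linearly independent. -/
theorem eq_zero_of_sum_mul_monomials {σ τ : Type*} [Fintype σ] [Fintype τ] {t : ℕ}
    [Fintype (Sym σ t)] [Fintype (Sym τ t)] {c : Sym σ t × Sym τ t → ℂ}
    (h : ∀ (x : σ → ℂ) (y : τ → ℂ), ∑ p, c p *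
      (((p.1 : Multiset σ).map x).prod * ((p.2 : Multiset τ).map y).prod) = 0) : c = 0 := by
  have h₁ : ∀ x B, ∑ A, c (A, B) * ((A : Multiset σ).map x).prod = 0 := by
    intro x
    refine Fintype.linearIndependent_iff.1 (linearIndependent_monomial_functions τ t)
      (fun B => ∑ A, c (A, B) * ((A : Multiset σ).map x).prod) ?_
    ext y
    refine Eq.trans ?_ (h x y)
    rw [Fintype.sum_prod_type_right]
    simp only [Finset.sum_apply, Pi.smul_apply, smul_eq_mul, Finset.sum_mul, mul_assoc]
  ext ⟨A, B⟩
  refine Fintype.linearIndependent_iff.1 (linearIndependent_monomial_functions σ t)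
      (fun A => c (A, B)) ?_ A
  ext x
  simpa only [Finset.sum_apply, Pi.smul_apply, smul_eq_mul, Pi.zero_apply] using h₁ x B

end Monomials

section Segre

variable {n : ℕ}

theorem tensorCovector_realBasis {𝕜 : Type*} [Field 𝕜] [Algebra ℝ 𝕜] (l : ℂ →ₗ[ℝ] 𝕜)
    (ξ : (Fin n → ℝ) →ₗ[ℝ] 𝕜) (q : (_ : Fin n) × Fin 2) :
    tensorCovector l ξ (realBasis n q) = l (Complex.basisOneI q.2) * ξ (Pi.single q.1 1) := by
  obtain ⟨i, a⟩ := q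
  fin_cases a
  · simp [realBasis_zero, tensorCovector_reVec]
  · simp [realBasis_one, tensorCovector_imVec]

/-- The cone over the variety of decomposable covectors, without its vertex. -/
abbrev SegreCone (n : ℕ) : Type :=
  {v : (Fin n → ℂ) →ₗ[ℝ] ℂ // ∃ h : v ≠ 0, Projectivization.mk ℂ v h ∈ decomposableCovectors ℂ n}

theorem SegreCone.exists_eq_tensorCovector (v : SegreCone n) :
    ∃ (l : ℂ →ₗ[ℝ] ℂ) (ξ : (Fin n → ℝ) →ₗ[ℝ] ℂ),
      (v : (Fin n → ℂ) →ₗ[ℝ] ℂ) = tensorCovector l ξ := by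
  obtain ⟨v, h0, l, ξ, h, hv⟩ := v
  obtain ⟨c, hc⟩ := (Projectivization.mk_eq_mk_iff' ℂ _ _ h0 h).1 hv
  refine ⟨c • l, ξ, ?_⟩
  change v = _
  rw [← hc]
  refine (realBasis n).ext fun q => ?_
  rw [LinearMap.smul_apply, tensorCovector_realBasis, tensorCovector_realBasis,
    LinearMap.smul_apply, smul_mul_assoc]

/-- The product of the coordinates with the indices `f 0, …, f (t - 1)`, on the Segre cone. -/
noncomputable def coordinateProduct {t : ℕ} (f : Fin t → (_ : Fin n) × Fin 2)
    (v : SegreCone n) : ℂ :=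
  ∏ i, (v : (Fin n → ℂ) →ₗ[ℝ] ℂ) (realBasis n (f i))

/-- On `l ⊗ ξ`, a product of coordinates is a monomial in the components of `l` times a monomial in
the components of `ξ`. -/
theorem prod_tensorCovector {t : ℕ} (f : Fin t → (_ : Fin n) × Fin 2) (l : ℂ →ₗ[ℝ] ℂ)
    (ξ : (Fin n → ℝ) →ₗ[ℝ] ℂ) :
    ∏ i, tensorCovector l ξ (realBasis n (f i)) =
      ((Finset.univ.val.map fun i => (f i).2).map fun a => l (Complex.basisOneI a)).prod *
        ((Finset.univ.val.map fun i => (f i).1).map fun k => ξ (Pi.single k 1)).prod := by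
  simp only [tensorCovector_realBasis, Finset.prod_mul_distrib, Multiset.map_map]
  rfl

/-- Products of linear forms may be expanded into products of coordinates. -/
theorem homogeneousCoordinatePart_decomposable (t : ℕ) :
    homogeneousCoordinatePart (decomposableCovectors ℂ n) t =
      Submodule.span ℂ (Set.range (coordinateProduct (n := n) (t := t))) := by
  refine le_antisymm (Submodule.span_le.2 ?_) (Submodule.span_le.2 ?_)
  · rintro _ ⟨ℓ, rfl⟩
    -- the linear form `ℓ i` is a combination of the coordinates
    have h : ∀ (i : Fin t) (v : (Fin n → ℂ) →ₗ[ℝ] ℂ), ℓ i v =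
        ∑ q, ℓ i ((realBasis n).constr ℝ (Pi.single q 1)) * v (realBasis n q) := by
      intro i v
      have hv : v = ∑ q, v (realBasis n q) • (realBasis n).constr ℝ (Pi.single q (1 : ℂ)) := by
        refine (realBasis n).ext fun q => ?_
        rw [LinearMap.sum_apply, Finset.sum_eq_single q]
        · simp
        · intro r _ hr
          simp [hr.symm]
        · simp
      conv_lhs => rw [hv]
      simp only [map_sum, map_smul, smul_eq_mul, mul_comm]
    have : (fun v : SegreCone n => ∏ i, ℓ i (v : (Fin n → ℂ) →ₗ[ℝ] ℂ)) =
        ∑ f : Fin t → (_ : Fin n) × Fin 2,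
          (∏ i, ℓ i ((realBasis n).constr ℝ (Pi.single (f i) 1))) • coordinateProduct f := by
      ext v
      rw [Finset.prod_congr rfl fun i _ => h i v]
      simp only [Finset.prod_univ_sum, Fintype.piFinset_univ, Finset.sum_apply, Pi.smul_apply,
        smul_eq_mul, coordinateProduct, Finset.prod_mul_distrib]
    change (fun v : SegreCone n => ∏ i, ℓ i (v : (Fin n → ℂ) →ₗ[ℝ] ℂ)) ∈ _
    rw [this]
    exact Submodule.sum_mem _ fun f _ =>
      Submodule.smul_mem _ _ (Submodule.subset_span (Set.mem_range_self f))
  · rintro _ ⟨f, rfl⟩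
    refine Submodule.subset_span ⟨fun i =>
      { toFun := fun v => v (realBasis n (f i))
        map_add' := fun _ _ => rfl
        map_smul' := fun _ _ => rfl }, rfl⟩

/-- The Hilbert function of the variety of decomposable covectors is that of the Segre variety
`ℙ¹ × ℙⁿ⁻¹`: the space of forms of bidegree `(t, t)`. -/
theorem finrank_homogeneousCoordinatePart {t : ℕ} (ht : t ≠ 0) :
    finrank ℂ (homogeneousCoordinatePart (decomposableCovectors ℂ n) t) =
      (t + 1) * n.multichoose t := by
  have hf : ∀ p : Sym (Fin 2) t × Sym (Fin n) t, ∃ f : Fin t → (_ : Fin n) × Fin 2,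
      (Finset.univ.val.map fun i => (f i).2) = (p.1 : Multiset (Fin 2)) ∧
        (Finset.univ.val.map fun i => (f i).1) = (p.2 : Multiset (Fin n)) := by
    rintro ⟨A, B⟩
    obtain ⟨a, ha⟩ := A.exists_map_univ_eq
    obtain ⟨b, hb⟩ := B.exists_map_univ_eq
    exact ⟨fun i => ⟨b i, a i⟩, ha, hb⟩
  -- the product of the coordinates `F p` is the monomial of bidegree `(t, t)` given by `p`
  choose F hF₁ hF₂ using hf
  have hrange : Set.range (coordinateProduct (n := n) (t := t)) =
      Set.range fun p => coordinateProduct (F p) := by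
    refine Set.Subset.antisymm ?_ (Set.range_comp_subset_range F coordinateProduct)
    rintro _ ⟨f, rfl⟩
    refine ⟨⟨⟨Finset.univ.val.map fun i => (f i).2, by simp⟩,
      ⟨Finset.univ.val.map fun i => (f i).1, by simp⟩⟩, ?_⟩
    ext v
    obtain ⟨l, ξ, hv⟩ := v.exists_eq_tensorCovector
    simp only [coordinateProduct, hv, prod_tensorCovector, hF₁, hF₂]
    rfl
  have hli : LinearIndependent ℂ fun p => coordinateProduct (F p) := by
    rw [Fintype.linearIndependent_iff]
    intro c hc p
    suffices c = 0 from congrFun this p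
    refine eq_zero_of_sum_mul_monomials fun x y => ?_
    obtain ⟨l, hl1, hlI⟩ := exists_linearMap_complex_eq (x 0) (x 1)
    obtain ⟨ξ, hξ⟩ := exists_linearMap_pi_eq y
    have hl : (fun a => l (Complex.basisOneI a)) = x := by
      ext a
      fin_cases a
      · simpa using hl1
      · simpa using hlI
    have hξ' : (fun k => ξ (Pi.single k 1)) = y := funext hξ
    have hprod : ∀ p : Sym (Fin 2) t × Sym (Fin n) t,
        ((p.1 : Multiset (Fin 2)).map x).prod * ((p.2 : Multiset (Fin n)).map y).prod =
          ∏ i, tensorCovector l ξ (realBasis n (F p i)) := fun p => by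
      rw [prod_tensorCovector, hF₁, hF₂, hl, hξ']
    simp only [hprod]
    -- the relation is known only away from the vertex, where the forms of positive degree vanish
    by_cases h0 : tensorCovector l ξ = 0
    · refine Finset.sum_eq_zero fun p _ => ?_
      have : NeZero t := ⟨ht⟩
      rw [Finset.prod_eq_zero (Finset.mem_univ (0 : Fin t)) (by rw [h0]; rfl), mul_zero]
    · have := congrFun hc ⟨tensorCovector l ξ, h0, l, ξ, h0, rfl⟩
      simpa only [Finset.sum_apply, Pi.smul_apply, smul_eq_mul, coordinateProduct,
        Pi.zero_apply] using this
  rw [homogeneousCoordinatePart_decomposable, hrange, finrank_span_eq_card hli, Fintype.card_prod,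
    Sym.card_sym_eq_multichoose, Sym.card_sym_eq_multichoose, Fintype.card_fin, Fintype.card_fin,
    Nat.multichoose_two]

theorem tendsto_multichoose_div_pow (m : ℕ) :
    Filter.Tendsto (fun t : ℕ => (m.factorial : ℝ) * ((m + 1).multichoose t : ℝ) / (t : ℝ) ^ m)
      Filter.atTop (nhds 1) := by
  have h : ∀ t : ℕ, (m.factorial : ℝ) * ((m + 1).multichoose t : ℝ) =
      ∏ i ∈ Finset.range m, ((t : ℝ) + (i + 1)) := by
    intro t
    rw [Nat.multichoose_eq, show m + 1 + t - 1 = t + m by omega, Nat.choose_symm_add,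
      ← Nat.cast_mul, ← Nat.ascFactorial_eq_factorial_mul_choose, Nat.ascFactorial_eq_prod_range]
    push_cast
    exact Finset.prod_congr rfl fun i _ => by ring
  have hlim : Filter.Tendsto (fun t : ℕ => ∏ i ∈ Finset.range m, (1 + ((i : ℝ) + 1) / (t : ℝ)))
      Filter.atTop (nhds (∏ i ∈ Finset.range m, (1 : ℝ))) := by
    refine tendsto_finsetProd _ fun i _ => ?_
    simpa using (tendsto_const_div_atTop_nhds_zero_nat ((i : ℝ) + 1)).const_add 1
  rw [Finset.prod_const_one] at hlim
  refine hlim.congr' ?_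
  filter_upwards [Filter.eventually_ne_atTop 0] with t ht
  have ht' : (t : ℝ) ≠ 0 := Nat.cast_ne_zero.2 ht
  rw [h, ← Finset.card_range m, ← Finset.prod_const, Finset.card_range, ← Finset.prod_div_distrib]
  refine Finset.prod_congr rfl fun i _ => ?_
  field_simp

theorem hasProjectiveDegree_decomposableCovectors (hn : n ≠ 0) :
    HasProjectiveDegree (decomposableCovectors ℂ n) n := by
  obtain ⟨m, rfl⟩ := Nat.exists_eq_succ_of_ne_zero hn
  -- the cone without its vertex has dimension `n + 1`, and the variety has dimension `n`
  refine ⟨m.succ_pos, m + 1, ?_⟩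
  have hlim : Filter.Tendsto (fun t : ℕ => ((m : ℝ) + 1) * ((1 + 1 / (t : ℝ)) *
      ((m.factorial : ℝ) * ((m + 1).multichoose t : ℝ) / (t : ℝ) ^ m)))
      Filter.atTop (nhds (((m : ℝ) + 1) * ((1 + 0) * 1))) :=
    (((tendsto_const_div_atTop_nhds_zero_nat 1).const_add 1).mul
      (tendsto_multichoose_div_pow m)).const_mul _
  rw [show ((m : ℝ) + 1) * ((1 + 0) * 1) = ((m.succ : ℕ) : ℝ) by push_cast; ring] at hlim
  refine hlim.congr' ?_
  filter_upwards [Filter.eventually_ne_atTop 0] with t ht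
  have ht' : (t : ℝ) ≠ 0 := Nat.cast_ne_zero.2 ht
  rw [finrank_homogeneousCoordinatePart ht, Nat.factorial_succ, pow_succ]
  push_cast
  field_simp

end Segre

theorem mainTheorem8 (n : ℕ) (hn : 2 ≤ n) :
    (integrableCurvature n).IsInvolutive ∧
    (∀ k : ℕ, k ≤ 2 * n → (integrableCurvature n).cartanCharacter k =
      if 2 ≤ k ∧ k ≤ n + 1 then
        (k : ℤ) - 1 + (n : ℤ) * ((n : ℤ) + ((k : ℤ) - 2) * ((n : ℤ) + 1 - (k : ℤ)))
      else 0) ∧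
    SecondLevelTableau.characteristicVariety ℝ (integrableCurvature n) =
      decomposableCovectors ℝ n ∧
    SecondLevelTableau.characteristicVariety ℂ (integrableCurvature n) =
      decomposableCovectors ℂ n ∧
    HasProjectiveDegree
      (SecondLevelTableau.characteristicVariety ℂ (integrableCurvature n)) n := by
  have : NeZero n := ⟨by omega⟩
  refine ⟨isInvolutive_integrableCurvature, fun k hk => cartanCharacter_eq hk,
    characteristicVariety_eq ℝ, characteristicVariety_eq ℂ, ?_⟩
  rw [characteristicVariety_eq]
  exact hasProjectiveDegree_decomposableCovectors (by omega)
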